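/- Let $n\ge 3$, $p,q>1$, and let $a,b\in\mathbb{R}$ satisfy $a,b>-n$ and $\frac{a+n}{p}+\frac{b+n}{q}>n-2$. Let $B\subset\mathbb{R}^n$ be an open ball of radius $R>0$ centred at the origin. Then there exist $\lambda_1,\lambda_2>0$ and radial functions $u,v:B\to(0,\infty)$ such that $$-\Delta u=\lambda_1|x|^a v^{p-1},\qquad -\Delta v=\lambda_2|x|^b u^{q-1}\qquad\text{in the sense of distributions on } B$$ (in particular both right-hand sides are locally integrable on $B$), with $u=v=0$ on $\partial B$ in the sense that $u,v\in W^{1,1}_0(B)$ (the closure of $C_c^\infty(B)$ in $W^{1,1}(B)$), and moreover $$u,v\in W^{2,1}(B)\cap W^{1,1}_0(B),\qquad \int_B|x|^b|u|^q\,dx<\infty,\qquad \int_B|x|^a|v|^p\,dx<\infty.$$ -/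

import Mathlib

open scoped ENNReal Distributions
open MeasureTheory TopologicalSpace

noncomputable section

namespace HenonLaneEmden

/-- The partial derivative `∂ᵢ φ` of a function on `ℝⁿ`. -/
def partialDeriv {n : ℕ} (i : Fin n) (φ : EuclideanSpace ℝ (Fin n) → ℝ) :
    EuclideanSpace ℝ (Fin n) → ℝ :=
  fun x => fderiv ℝ φ x (EuclideanSpace.single i 1)

/-- `g` is the weak partial derivative `∂ᵢ u` on the open set `Ω`: both functions are locally
integrable on `Ω` and `∫ u ∂ᵢφ = - ∫ g φ` for all test functions `φ ∈ C_c^∞(Ω)`. -/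
def IsWeakPartialDeriv {n : ℕ} (Ω : Opens (EuclideanSpace ℝ (Fin n))) (i : Fin n)
    (u g : EuclideanSpace ℝ (Fin n) → ℝ) : Prop :=
  LocallyIntegrableOn u Ω ∧ LocallyIntegrableOn g Ω ∧
    ∀ φ : 𝓓(Ω, ℝ),
      ∫ x in (Ω : Set (EuclideanSpace ℝ (Fin n))), u x * partialDeriv i φ x =
        - ∫ x in (Ω : Set (EuclideanSpace ℝ (Fin n))), g x * φ x

/-- Membership in the Sobolev space `W^{k,r}(Ω)`: all weak partial derivatives of order at most
`k` exist and belong to `L^r(Ω)`. -/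
def MemSobolev {n : ℕ} (Ω : Opens (EuclideanSpace ℝ (Fin n))) (r : ℝ≥0∞) :
    ℕ → (EuclideanSpace ℝ (Fin n) → ℝ) → Prop
  | 0, u => MemLp u r (volume.restrict Ω)
  | k + 1, u => MemLp u r (volume.restrict Ω) ∧
      ∀ i : Fin n, ∃ g : EuclideanSpace ℝ (Fin n) → ℝ,
        IsWeakPartialDeriv Ω i u g ∧ MemSobolev Ω r k g

/-- Membership in `W^{1,r}_0(Ω)`, the closure of `C_c^∞(Ω)` in `W^{1,r}(Ω)`. The family `G` is
the weak gradient of `u`. -/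
def MemSobolevZero {n : ℕ} (Ω : Opens (EuclideanSpace ℝ (Fin n))) (r : ℝ≥0∞)
    (u : EuclideanSpace ℝ (Fin n) → ℝ) : Prop :=
  MemLp u r (volume.restrict Ω) ∧
    ∃ G : Fin n → EuclideanSpace ℝ (Fin n) → ℝ,
      (∀ i, IsWeakPartialDeriv Ω i u (G i) ∧ MemLp (G i) r (volume.restrict Ω)) ∧
      ∀ ε : ℝ≥0∞, 0 < ε → ∃ φ : 𝓓(Ω, ℝ),
        eLpNorm (fun x => u x - φ x) r (volume.restrict Ω) < ε ∧
        ∀ i, eLpNorm (fun x => G i x - partialDeriv i φ x) r (volume.restrict Ω) < ε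

/-- `-Δ u = f` on `Ω` in the sense of distributions. -/
def NegLaplacianEq {n : ℕ} (Ω : Opens (EuclideanSpace ℝ (Fin n)))
    (u f : EuclideanSpace ℝ (Fin n) → ℝ) : Prop :=
  LocallyIntegrableOn u Ω ∧ LocallyIntegrableOn f Ω ∧
    ∀ φ : 𝓓(Ω, ℝ),
      - ∫ x in (Ω : Set (EuclideanSpace ℝ (Fin n))), u x * Laplacian.laplacian (φ : _ → ℝ) x =
        ∫ x in (Ω : Set (EuclideanSpace ℝ (Fin n))), f x * φ x

/-- The open ball of radius `R` about the origin, as an open set. -/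
def originBall (n : ℕ) (R : ℝ) : Opens (EuclideanSpace ℝ (Fin n)) :=
  ⟨Metric.ball 0 R, Metric.isOpen_ball⟩

/-- `u` is radial on `Ω`: its value depends on `|x|` only. -/
def IsRadialOn {n : ℕ} (Ω : Opens (EuclideanSpace ℝ (Fin n)))
    (u : EuclideanSpace ℝ (Fin n) → ℝ) : Prop :=
  ∃ w : ℝ → ℝ, ∀ x ∈ Ω, u x = w ‖x‖

/-- `u, v` is a positive (weak) solution on `Ω` of the Dirichlet problem for
`-Δu = lam₁ |x|^a v^(p-1)`, `-Δv = lam₂ |x|^b u^(q-1)`. The equations hold in the sense of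
distributions on `Ω` and the boundary condition is membership in `W^{1,1}_0(Ω)`. -/
structure IsPositiveDirichletSolution {n : ℕ} (Ω : Opens (EuclideanSpace ℝ (Fin n)))
    (a b p q lam₁ lam₂ : ℝ) (u v : EuclideanSpace ℝ (Fin n) → ℝ) : Prop where
  eq_u : NegLaplacianEq Ω u (fun x => lam₁ * ‖x‖ ^ a * v x ^ (p - 1))
  eq_v : NegLaplacianEq Ω v (fun x => lam₂ * ‖x‖ ^ b * u x ^ (q - 1))
  pos_u : ∀ x ∈ Ω, 0 < u x
  pos_v : ∀ x ∈ Ω, 0 < v x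
  boundary_u : MemSobolevZero Ω 1 u
  boundary_v : MemSobolevZero Ω 1 v

end HenonLaneEmden

end

/-!
# A radial positive solution of the Hénon-Lane-Emden system below the critical hyperbola

For radial densities the Dirichlet problem `-Δu = f` on the ball is solved by
`u(r) = ∫ G(r, t) f(t) t^(n-1) dt` over `0 < t < R`, where `G(r, t) = ∫ s^(1-n) ds` over
`max r t < s < R`. Since the two constants `lam₁`, `lam₂` are free, it suffices to find an eigenpair
`u = c ∫ G v^(p-1) dμ`, `v = ∫ G u^(q-1) dν`, with `dμ = t^(a+n-1) dt` and `dν = t^(b+n-1) dt`.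

The kernel satisfies `G(t, r) ≤ t^(-τ) r^(-σ)` whenever `σ, τ ≥ 0` and `σ + τ = n - 2`, and the
hypothesis on `a, b, p, q` says exactly that `σ`, `τ` can be chosen with `t^(-τ) ∈ L^p(μ)` and
`r^(-σ) ∈ L^q(ν)` (`greenKernel_le`, `exists_split_exponent`). Hence `K φ = ∫ G φ dμ` is a compact
operator from `L^{p'}(μ)` to `L^q(ν)`: along a sequence in the unit ball, weak compactness gives
pointwise convergence of `K φ`, and the product bound dominates. A maximiser of `‖K φ‖_q` exists,
and the equality case of Hölder's inequality turns it into the eigenpair (`exists_eigenpair`).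

The product bound survives in the form `u ≤ C r^(-σ)`, `v ≤ C t^(-τ)`, so that both densities are
`O(t^(κ-n))` with `κ > 0`. A bootstrap through the integral equations shows that the profiles are
`C²` on `(0, R)`. The resulting functions on the ball are therefore classical solutions away from
the origin, with `∇u = O(|x|^(1-n+κ))` and `D²u = O(|x|^(κ-n))`. These rates make the error terms of
a cutoff near the origin vanish, so classical derivatives are weak derivatives
(`isWeakPartialDeriv_partialDeriv`); the same cutoff, placed also along the sphere, followed by a
mollification, shows that `u` and `v` belong to `W^{1,1}_0` (`memSobolevZero_of_puncturedBall`).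
-/

open Filter Topology

namespace HenonLaneEmden

/-! ### Eigenpairs of positive kernels dominated by a product -/

/-- Dictionary between `lintegral` conditions on an `ℝ≥0∞`-valued function and `L^p` membership of
its real-valued version. -/
theorem memLp_toReal_of_lintegral_rpow {X : Type*} [MeasurableSpace X] {μ : Measure X}
    {p : ℝ} (hp : 0 < p) {w : X → ℝ≥0∞} (hw : Measurable w) (hfin : ∫⁻ x, w x ^ p ∂μ ≠ ∞) :
    MemLp (fun x => (w x).toReal) (ENNReal.ofReal p) μ ∧
      eLpNorm (fun x => (w x).toReal) (ENNReal.ofReal p) μ = (∫⁻ x, w x ^ p ∂μ) ^ (1 / p) ∧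
      ∀ᵐ x ∂μ, w x ≠ ∞ := by
  have hae : ∀ᵐ x ∂μ, w x ≠ ∞ := by
    filter_upwards [ae_lt_top (hw.pow_const p) hfin] with x hx h
    simp [h, hp] at hx
  have hnorm : eLpNorm (fun x => (w x).toReal) (ENNReal.ofReal p) μ
      = (∫⁻ x, w x ^ p ∂μ) ^ (1 / p) := by
    rw [eLpNorm_eq_lintegral_rpow_enorm_toReal (by simpa using hp) (by simp),
      ENNReal.toReal_ofReal hp.le]
    congr 1
    refine lintegral_congr_ae ?_
    filter_upwards [hae] with x hx
    rw [Real.enorm_eq_ofReal ENNReal.toReal_nonneg, ENNReal.ofReal_toReal hx]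
  refine ⟨⟨hw.ennreal_toReal.aestronglyMeasurable, ?_⟩, hnorm, hae⟩
  rw [hnorm]
  exact ENNReal.rpow_lt_top_of_nonneg (by positivity) hfin

/-- Sequential weak compactness of the unit ball of `L^{p'}` acting on `L^p`, for nonnegative
functions with values in `ℝ≥0∞`. -/
theorem exists_subseq_tendsto_lintegral_mul {X : Type*} [MeasurableSpace X]
    [MeasurableSpace.CountablyGenerated X] {μ : Measure X} [SigmaFinite μ] {p p' : ℝ}
    (hpp : p.HolderConjugate p') (φ : ℕ → X → ℝ≥0∞) (hφ : ∀ k, Measurable (φ k))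
    (hφ1 : ∀ k, ∫⁻ x, φ k x ^ p' ∂μ ≤ 1) :
    ∃ s : ℕ → ℕ, StrictMono s ∧ ∀ w : X → ℝ≥0∞, Measurable w → ∫⁻ x, w x ^ p ∂μ ≠ ∞ →
      ∃ l : ℝ≥0∞, Tendsto (fun k => ∫⁻ x, w x * φ (s k) x ∂μ) atTop (𝓝 l) := by
  have : Fact (1 ≤ ENNReal.ofReal p) := ⟨by simpa using hpp.lt.le⟩
  have : Fact (1 ≤ ENNReal.ofReal p') := ⟨by simpa using hpp.symm.lt.le⟩
  have : Fact (ENNReal.ofReal p ≠ ∞) := ⟨by simp⟩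
  have : (ENNReal.ofReal p').HolderConjugate (ENNReal.ofReal p) := hpp.symm.ennrealOfReal
  have hφtop k : ∫⁻ x, φ k x ^ p' ∂μ ≠ ∞ := ((hφ1 k).trans_lt ENNReal.one_lt_top).ne
  have hm k := memLp_toReal_of_lintegral_rpow hpp.symm.pos (hφ k) (hφtop k)
  let B := (ContinuousLinearMap.mul ℝ ℝ).lpPairing μ (ENNReal.ofReal p') (ENNReal.ofReal p)
  let L : ℕ → StrongDual ℝ (Lp ℝ (ENNReal.ofReal p) μ) := fun k => B ((hm k).1.toLp _)
  have hL k : ‖L k‖ ≤ ‖B‖ := by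
    refine (B.le_opNorm _).trans (mul_le_of_le_one_right (norm_nonneg _) ?_)
    rw [Lp.norm_toLp, (hm k).2.1]
    refine ENNReal.toReal_le_of_le_ofReal zero_le_one ?_
    simpa using ENNReal.rpow_le_one (hφ1 k) (inv_nonneg.2 hpp.symm.nonneg)
  obtain ⟨ℓ, -, s, hs, hlim⟩ := WeakDual.isSeqCompact_closedBall ℝ (Lp ℝ (ENNReal.ofReal p) μ)
    (0 : StrongDual ℝ (Lp ℝ (ENNReal.ofReal p) μ)) ‖B‖
    (x := fun k => StrongDual.toWeakDual (L k)) (fun k => by simpa using hL k)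
  refine ⟨s, hs, fun w hw hwfin => ?_⟩
  obtain ⟨w1, -, w3⟩ := memLp_toReal_of_lintegral_rpow hpp.pos hw hwfin
  refine ⟨ENNReal.ofReal (ℓ (w1.toLp _)), ?_⟩
  have h1 : Tendsto (fun k => L (s k) (w1.toLp _)) atTop (𝓝 (ℓ (w1.toLp _))) :=
    ((WeakDual.eval_continuous (𝕜 := ℝ) (w1.toLp _)).tendsto ℓ).comp hlim
  refine (ENNReal.tendsto_ofReal h1).congr fun k => ?_
  have h2 : L (s k) (w1.toLp _) = ∫ x, (φ (s k) x).toReal * (w x).toReal ∂μ := by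
    refine (ContinuousLinearMap.lpPairing_eq_integral _ _ _).trans (integral_congr_ae ?_)
    filter_upwards [w1.coeFn_toLp, (hm (s k)).1.coeFn_toLp] with x hx hx'
    simp [hx, hx']
  have hint : Integrable (fun x => (φ (s k) x).toReal * (w x).toReal) μ :=
    (hm (s k)).1.integrable_mul w1
  rw [h2, ofReal_integral_eq_lintegral_ofReal hint (ae_of_all _ fun x => by positivity)]
  refine lintegral_congr_ae ?_
  filter_upwards [w3, (hm (s k)).2.2] with x hx hx'
  rw [ENNReal.ofReal_mul ENNReal.toReal_nonneg, ENNReal.ofReal_toReal hx, ENNReal.ofReal_toReal hx',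
    mul_comm]

/-- Tangent-line inequality for `t ↦ t ^ q`, with its equality case. -/
theorem rpow_tangent_le {q : ℝ} (hq : 1 < q) {s t : ℝ} (hs : 0 ≤ s) (ht : 0 ≤ t) :
    q * (t ^ (q - 1) * s) ≤ s ^ q + (q - 1) * t ^ q ∧
      (q * (t ^ (q - 1) * s) = s ^ q + (q - 1) * t ^ q → s = t) := by
  rcases ht.eq_or_lt with rfl | ht
  · rw [Real.zero_rpow (by linarith), Real.zero_rpow (by linarith)]
    refine ⟨by simpa using Real.rpow_nonneg hs q, fun h => ?_⟩
    rw [zero_mul, mul_zero, mul_zero, add_zero] at h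
    exact (Real.rpow_eq_zero hs (by linarith)).1 h.symm
  have hpos : 0 < t ^ q := Real.rpow_pos_of_pos ht q
  have e1 : s ^ q = t ^ q * (1 + (s / t - 1)) ^ q := by
    rw [show 1 + (s / t - 1) = s / t by ring, Real.div_rpow hs ht.le]
    field_simp
  have e2 : t ^ (q - 1) * s = t ^ q * (s / t) := by
    rw [Real.rpow_sub_one ht.ne']
    ring
  have hb : -1 ≤ s / t - 1 := by
    have := div_nonneg hs ht.le
    linarith
  rw [e1, e2]
  constructor
  · nlinarith [one_add_mul_self_le_rpow_one_add hb hq.le]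
  · intro h
    by_contra hst
    have hne : s / t - 1 ≠ 0 := by
      intro h0
      apply hst
      field_simp at h0
      linarith
    nlinarith [one_add_mul_self_lt_rpow_one_add hb hne hq]

/-- Equality case of Hölder's inequality for the pair `f`, `u ^ (q - 1)`. -/
theorem ae_eq_of_lintegral_rpow_le {Y : Type*} [MeasurableSpace Y] {ν : Measure Y} {q : ℝ}
    (hq : 1 < q) {f u : Y → ℝ≥0∞} (hf : Measurable f) (hu : Measurable u)
    (hutop : ∫⁻ y, u y ^ q ∂ν ≠ ∞)
    (hfu : ∫⁻ y, f y ^ q ∂ν ≤ ∫⁻ y, u y ^ q ∂ν)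
    (hmul : ∫⁻ y, u y ^ q ∂ν ≤ ∫⁻ y, u y ^ (q - 1) * f y ∂ν) : f =ᵐ[ν] u := by
  have hq0 : 0 < q := by linarith
  have hftop : ∫⁻ y, f y ^ q ∂ν ≠ ∞ := (hfu.trans_lt hutop.lt_top).ne
  have hu3 := (memLp_toReal_of_lintegral_rpow hq0 hu hutop).2.2
  have hf3 := (memLp_toReal_of_lintegral_rpow hq0 hf hftop).2.2
  have key : ∀ y, u y ≠ ∞ → f y ≠ ∞ →
      ENNReal.ofReal q * (u y ^ (q - 1) * f y)
          ≤ f y ^ q + ENNReal.ofReal (q - 1) * u y ^ q ∧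
        (ENNReal.ofReal q * (u y ^ (q - 1) * f y)
          = f y ^ q + ENNReal.ofReal (q - 1) * u y ^ q → f y = u y) := by
    intro y h1 h2
    have ef : f y = ENNReal.ofReal (f y).toReal := (ENNReal.ofReal_toReal h2).symm
    have eu : u y = ENNReal.ofReal (u y).toReal := (ENNReal.ofReal_toReal h1).symm
    have hs : 0 ≤ (f y).toReal := ENNReal.toReal_nonneg
    have ht : 0 ≤ (u y).toReal := ENNReal.toReal_nonneg
    have hq1 : 0 ≤ q - 1 := by linarith
    have hR := rpow_tangent_le hq hs ht
    rw [ef, eu]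
    generalize (f y).toReal = s at *
    generalize (u y).toReal = t at *
    have := Real.rpow_nonneg ht (q - 1)
    have h3 := Real.rpow_nonneg ht q
    have h4 := Real.rpow_nonneg hs q
    rw [ENNReal.ofReal_rpow_of_nonneg ht hq1, ENNReal.ofReal_rpow_of_nonneg ht hq0.le,
      ENNReal.ofReal_rpow_of_nonneg hs hq0.le, ← ENNReal.ofReal_mul (by positivity),
      ← ENNReal.ofReal_mul (by positivity), ← ENNReal.ofReal_mul (by positivity),
      ← ENNReal.ofReal_add (by positivity) (by positivity)]
    refine ⟨ENNReal.ofReal_le_ofReal hR.1, fun h => ?_⟩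
    rw [ENNReal.ofReal_eq_ofReal_iff (by positivity) (by positivity)] at h
    rw [hR.2 h]
  have hsum : ∫⁻ y, f y ^ q + ENNReal.ofReal (q - 1) * u y ^ q ∂ν
      ≤ ENNReal.ofReal q * ∫⁻ y, u y ^ q ∂ν := by
    rw [lintegral_add_left (hf.pow_const q), lintegral_const_mul _ (hu.pow_const q)]
    calc _ ≤ ∫⁻ y, u y ^ q ∂ν + ENNReal.ofReal (q - 1) * ∫⁻ y, u y ^ q ∂ν := by gcongr
      _ = (ENNReal.ofReal 1 + ENNReal.ofReal (q - 1)) * ∫⁻ y, u y ^ q ∂ν := by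
        rw [ENNReal.ofReal_one]; ring
      _ = _ := by rw [← ENNReal.ofReal_add zero_le_one (by linarith)]; simp
  have hle : (fun y => ENNReal.ofReal q * (u y ^ (q - 1) * f y))
      ≤ᵐ[ν] fun y => f y ^ q + ENNReal.ofReal (q - 1) * u y ^ q := by
    filter_upwards [hu3, hf3] with y h1 h2 using (key y h1 h2).1
  have hmeas : Measurable fun y => u y ^ (q - 1) * f y := (hu.pow_const _).mul hf
  have heq := ae_eq_of_ae_le_of_lintegral_le hle
    (((lintegral_mono_ae hle).trans hsum).trans_lt
      (ENNReal.mul_lt_top ENNReal.ofReal_lt_top hutop.lt_top)).ne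
    ((hf.pow_const q).add ((hu.pow_const q).const_mul _)).aemeasurable
    (by
      rw [lintegral_const_mul _ hmeas]
      exact hsum.trans (by gcongr))
  filter_upwards [heq, hu3, hf3] with y h0 h1 h2 using (key y h1 h2).2 h0

/-- A positive kernel dominated by a product `g ⊗ h` with `g ∈ L^p(μ)`, `h ∈ L^q(ν)` has a nonzero
nonnegative eigenpair for the coupled system `u = c ∫ k v^(p-1) dμ`, `v = ∫ k u^(q-1) dν`.
It comes from maximising the `L^q(ν)` norm of `∫ k φ dμ` over the unit ball of `L^{p'}(μ)`. -/
theorem exists_eigenpair {X Y : Type*} [MeasurableSpace X] [MeasurableSpace.CountablyGenerated X]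
    [MeasurableSpace Y] {μ : Measure X} [IsFiniteMeasure μ] {ν : Measure Y} [SFinite ν]
    (hμ : μ ≠ 0) (hν : ν ≠ 0) {p q : ℝ} (hp : 1 < p) (hq : 1 < q) {k : X → Y → ℝ≥0∞}
    (hk : Measurable (Function.uncurry k)) {g : X → ℝ≥0∞} {h : Y → ℝ≥0∞} (hg : Measurable g)
    (hh : Measurable h) (hkle : ∀ x y, k x y ≤ g x * h y) (hhtop : ∀ y, h y ≠ ∞)
    (hgp : ∫⁻ x, g x ^ p ∂μ ≠ ∞) (hhq : ∫⁻ y, h y ^ q ∂ν ≠ ∞)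
    (hpos : ∀ᵐ y ∂ν, ∀ᵐ x ∂μ, k x y ≠ 0) :
    ∃ (u : Y → ℝ≥0∞) (v : X → ℝ≥0∞) (c C : ℝ≥0∞), Measurable u ∧ Measurable v ∧
      c ≠ 0 ∧ c ≠ ∞ ∧ C ≠ ∞ ∧
      (∀ y, u y = c * ∫⁻ x, k x y * v x ^ (p - 1) ∂μ) ∧
      (∀ x, v x = ∫⁻ y, k x y * u y ^ (q - 1) ∂ν) ∧
      (∀ y, u y ≤ C * h y) ∧ (∀ x, v x ≤ C * g x) ∧
      ∫⁻ y, u y ^ q ∂ν ≠ 0 ∧ ∫⁻ x, v x ^ p ∂μ ≠ 0 := by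
  have hp0 : 0 < p := by linarith
  have hq0 : 0 < q := by linarith
  have hq1 : 0 < q - 1 := by linarith
  set p' := p.conjExponent with hp'
  have hpp : p.HolderConjugate p' := Real.HolderConjugate.conjExponent hp
  have hp'0 : 0 < p' := hpp.symm.pos
  have hmk : ∀ y, Measurable fun x => k x y := fun y => hk.comp (measurable_id.prodMk measurable_const)
  let K : (X → ℝ≥0∞) → Y → ℝ≥0∞ := fun φ y => ∫⁻ x, k x y * φ x ∂μ
  have hKm : ∀ φ, Measurable φ → Measurable (K φ) := fun φ hφ =>
    Measurable.lintegral_prod_left' (f := fun z : X × Y => k z.1 z.2 * φ z.1)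
      (hk.mul (hφ.comp measurable_fst))
  have holder : ∀ w φ : X → ℝ≥0∞, Measurable w → Measurable φ → ∫⁻ x, φ x ^ p' ∂μ ≤ 1 →
      ∫⁻ x, w x * φ x ∂μ ≤ (∫⁻ x, w x ^ p ∂μ) ^ (1 / p) := by
    intro w φ hw hφ h1
    refine (ENNReal.lintegral_mul_le_Lp_mul_Lq μ hpp hw.aemeasurable hφ.aemeasurable).trans ?_
    exact mul_le_of_le_one_right' (ENNReal.rpow_le_one h1 (by positivity))
  -- `A * h` dominates `K φ` for every `φ` in the unit ball.
  set A := (∫⁻ x, g x ^ p ∂μ) ^ (1 / p) with hA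
  have hAtop : A ≠ ∞ := (ENNReal.rpow_lt_top_of_nonneg (by positivity) hgp).ne
  have hKle : ∀ φ, Measurable φ → ∫⁻ x, φ x ^ p' ∂μ ≤ 1 → ∀ y, K φ y ≤ A * h y := by
    intro φ hφ h1 y
    calc K φ y ≤ ∫⁻ x, h y * (g x * φ x) ∂μ := by
          refine lintegral_mono fun x => ?_
          calc k x y * φ x ≤ g x * h y * φ x := by gcongr; exact hkle x y
            _ = _ := by ring
      _ = h y * ∫⁻ x, g x * φ x ∂μ := lintegral_const_mul _ (hg.mul hφ)
      _ ≤ h y * A := by gcongr; exact holder g φ hg hφ h1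
      _ = _ := mul_comm _ _
  have hAh : ∫⁻ y, (A * h y) ^ q ∂ν ≠ ∞ := by
    simp_rw [ENNReal.mul_rpow_of_nonneg _ _ hq0.le]
    rw [lintegral_const_mul _ (hh.pow_const q)]
    exact (ENNReal.mul_lt_top (ENNReal.rpow_lt_top_of_nonneg hq0.le hAtop) hhq.lt_top).ne
  -- `L` is the supremum of `∫ (K φ) ^ q dν` over the unit ball; `u` is the limit of `K φ` along a
  -- maximising sequence.
  let S : Set ℝ≥0∞ := {N | ∃ φ : X → ℝ≥0∞, Measurable φ ∧ ∫⁻ x, φ x ^ p' ∂μ ≤ 1 ∧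
    ∫⁻ y, K φ y ^ q ∂ν = N}
  set L := sSup S with hL
  have hLle : ∀ φ, Measurable φ → ∫⁻ x, φ x ^ p' ∂μ ≤ 1 → ∫⁻ y, K φ y ^ q ∂ν ≤ L :=
    fun φ hφ h1 => le_sSup ⟨φ, hφ, h1, rfl⟩
  have hLtop : L ≠ ∞ := by
    refine ((sSup_le ?_).trans_lt hAh.lt_top).ne
    rintro N ⟨φ, hφ, h1, rfl⟩
    exact lintegral_mono fun y => ENNReal.rpow_le_rpow (hKle φ hφ h1 y) hq0.le
  have hμ0 : μ Set.univ ≠ 0 := by simpa using hμ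
  have hL0 : L ≠ 0 := by
    intro h0
    -- A constant of unit norm has a positive image.
    have hc : (μ Set.univ ^ (-(1 / p'))) ^ p' * μ Set.univ = 1 := by
      rw [← ENNReal.rpow_mul, neg_mul, one_div, inv_mul_cancel₀ hp'0.ne', ENNReal.rpow_neg_one,
        ENNReal.inv_mul_cancel hμ0 (measure_ne_top μ _)]
    have h1 := hLle (fun _ => μ Set.univ ^ (-(1 / p'))) measurable_const
      (by rw [lintegral_const, hc])
    rw [h0, nonpos_iff_eq_zero, lintegral_eq_zero_iff ((hKm _ measurable_const).pow_const q)] at h1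
    have hF : ∀ᵐ y ∂ν, False := by
      filter_upwards [h1, hpos] with y hy hy'
      simp only [Pi.zero_apply, ENNReal.rpow_eq_zero_iff, hq0, not_lt_of_gt hq0, and_true,
        and_false, or_false] at hy
      have hm : Measurable fun x => k x y * μ Set.univ ^ (-(1 / p')) := (hmk y).mul_const _
      replace hy := (lintegral_eq_zero_iff hm).1 hy
      have hF' : ∀ᵐ x ∂μ, False := by
        filter_upwards [hy, hy'] with x h2 h3
        have h4 : μ Set.univ ^ (-(1 / p')) ≠ 0 := by
          simp [ENNReal.rpow_eq_zero_iff, hμ0, measure_ne_top μ]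
        exact (mul_ne_zero h3 h4) h2
      rw [ae_iff] at hF'
      simp at hF'
      exact hμ hF'
    rw [ae_iff] at hF
    simp at hF
    exact hν hF
  obtain ⟨N, -, hNlim, hNS⟩ := exists_seq_tendsto_sSup (S := S)
    ⟨_, 0, measurable_const, by simp [hp'0], rfl⟩ (OrderTop.bddAbove S)
  choose φ hφm hφ1 hφN using hNS
  obtain ⟨s, hs, hslim⟩ := exists_subseq_tendsto_lintegral_mul hpp φ hφm hφ1
  have hkp : ∀ y, ∫⁻ x, k x y ^ p ∂μ ≠ ∞ := by
    intro y
    refine ((lintegral_mono fun x => ENNReal.rpow_le_rpow (hkle x y) hp0.le).trans_lt ?_).ne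
    simp_rw [ENNReal.mul_rpow_of_nonneg _ _ hp0.le]
    rw [lintegral_mul_const _ (hg.pow_const p)]
    exact ENNReal.mul_lt_top hgp.lt_top (ENNReal.rpow_lt_top_of_nonneg hp0.le (hhtop y))
  choose u hulim using fun y => hslim (fun x => k x y) (hmk y) (hkp y)
  replace hulim : ∀ y, Tendsto (fun i => K (φ (s i)) y) atTop (𝓝 (u y)) := hulim
  have hum : Measurable u :=
    measurable_of_tendsto_metrizable (fun i => hKm _ (hφm (s i))) (tendsto_pi_nhds.2 hulim)
  have hule : ∀ y, u y ≤ A * h y := fun y =>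
    le_of_tendsto' (hulim y) fun i => hKle _ (hφm _) (hφ1 _) y
  have huq : ∫⁻ y, u y ^ q ∂ν = L := by
    refine tendsto_nhds_unique ?_ (hNlim.comp hs.tendsto_atTop)
    have := tendsto_lintegral_of_dominated_convergence (μ := ν)
      (F := fun i y => K (φ (s i)) y ^ q) (f := fun y => u y ^ q) (fun y => (A * h y) ^ q)
      (fun i => (hKm _ (hφm _)).pow_const q)
      (fun i => ae_of_all _ fun y => ENNReal.rpow_le_rpow (hKle _ (hφm _) (hφ1 _) y) hq0.le) hAh
      (ae_of_all _ fun y => (hulim y).ennrpow_const q)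
    exact this.congr fun i => hφN (s i)
  have hAhtop : ∀ y, A * h y ≠ ∞ := fun y => ENNReal.mul_ne_top hAtop (hhtop y)
  have hpow : ∀ t : ℝ≥0∞, t ^ (q - 1) * t = t ^ q := by
    intro t
    conv_lhs => rw [← ENNReal.rpow_one t, ← ENNReal.rpow_mul, one_mul]
    rw [← ENNReal.rpow_add_of_nonneg _ _ hq1.le zero_le_one]
    simp
  have hpow' : ∀ t : ℝ≥0∞, t ^ (p - 1) * t = t ^ p := by
    intro t
    conv_lhs => rw [← ENNReal.rpow_one t, ← ENNReal.rpow_mul, one_mul]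
    rw [← ENNReal.rpow_add_of_nonneg _ _ (by linarith) zero_le_one]
    simp
  let v : X → ℝ≥0∞ := fun x => ∫⁻ y, k x y * u y ^ (q - 1) ∂ν
  have hvm : Measurable v :=
    Measurable.lintegral_prod_right' (f := fun z : X × Y => k z.1 z.2 * u z.2 ^ (q - 1))
      (hk.mul ((hum.comp measurable_snd).pow_const _))
  set C := ∫⁻ y, h y * u y ^ (q - 1) ∂ν with hC
  have hCtop : C ≠ ∞ := by
    have h1 : C ≤ ∫⁻ y, A ^ (q - 1) * h y ^ q ∂ν := by
      refine lintegral_mono fun y => ?_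
      calc h y * u y ^ (q - 1) ≤ h y * (A * h y) ^ (q - 1) := by gcongr; exact hule y
        _ = A ^ (q - 1) * (h y ^ (q - 1) * h y) := by
          rw [ENNReal.mul_rpow_of_nonneg _ _ hq1.le]; ring
        _ = _ := by rw [hpow]
    rw [lintegral_const_mul _ (hh.pow_const q)] at h1
    exact (h1.trans_lt (ENNReal.mul_lt_top (ENNReal.rpow_lt_top_of_nonneg hq1.le hAtop)
      hhq.lt_top)).ne
  have hvle : ∀ x, v x ≤ C * g x := by
    intro x
    calc v x ≤ ∫⁻ y, (h y * u y ^ (q - 1)) * g x ∂ν := by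
          refine lintegral_mono fun y => ?_
          calc k x y * u y ^ (q - 1) ≤ g x * h y * u y ^ (q - 1) := by gcongr; exact hkle x y
            _ = _ := by ring
      _ = C * g x := lintegral_mul_const _ (hh.mul (hum.pow_const _))
  set P := ∫⁻ x, v x ^ p ∂μ with hP
  have hPtop : P ≠ ∞ := by
    refine ((lintegral_mono fun x => ENNReal.rpow_le_rpow (hvle x) hp0.le).trans_lt ?_).ne
    simp_rw [ENNReal.mul_rpow_of_nonneg _ _ hp0.le]
    rw [lintegral_const_mul _ (hg.pow_const p)]
    exact ENNReal.mul_lt_top (ENNReal.rpow_lt_top_of_nonneg hp0.le hCtop) hgp.lt_top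
  have hswap : ∀ φ : X → ℝ≥0∞, Measurable φ →
      ∫⁻ x, v x * φ x ∂μ = ∫⁻ y, u y ^ (q - 1) * K φ y ∂ν := by
    intro φ hφ
    have e1 : ∀ x, v x * φ x = ∫⁻ y, u y ^ (q - 1) * (k x y * φ x) ∂ν := by
      intro x
      have hm : Measurable fun y => k x y * u y ^ (q - 1) :=
        (hk.comp (measurable_const.prodMk measurable_id)).mul (hum.pow_const _)
      refine (lintegral_mul_const _ hm).symm.trans (lintegral_congr fun y => ?_)
      ring
    have e2 : ∀ y, u y ^ (q - 1) * K φ y = ∫⁻ x, u y ^ (q - 1) * (k x y * φ x) ∂μ := fun y =>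
      (lintegral_const_mul _ ((hmk y).mul hφ)).symm
    simp_rw [e1, e2]
    refine lintegral_lintegral_swap (Measurable.aemeasurable ?_)
    exact ((hum.comp measurable_snd).pow_const _).mul (hk.mul (hφ.comp measurable_fst))
  -- Testing `v` against the maximising sequence bounds its `L^p` norm from below.
  have hLP : L ≤ P ^ (1 / p) := by
    have h1 := tendsto_lintegral_of_dominated_convergence (μ := ν)
      (F := fun i y => u y ^ (q - 1) * K (φ (s i)) y) (f := fun y => u y ^ (q - 1) * u y)
      (fun y => (A * h y) ^ q)
      (fun i => (hum.pow_const _).mul (hKm _ (hφm _)))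
      (fun i => ae_of_all _ fun y => by
        refine le_of_le_of_eq ?_ (hpow (A * h y))
        exact mul_le_mul' (ENNReal.rpow_le_rpow (hule y) hq1.le) (hKle _ (hφm _) (hφ1 _) y)) hAh
      (ae_of_all _ fun y => ENNReal.Tendsto.const_mul (hulim y) (Or.inr
        (ENNReal.rpow_lt_top_of_nonneg hq1.le ((hule y).trans_lt (hAhtop y).lt_top).ne).ne))
    simp_rw [hpow] at h1
    rw [huq] at h1
    refine le_of_tendsto' h1 fun i => ?_
    rw [← hswap _ (hφm _)]
    exact holder v _ hvm (hφm _) (hφ1 _)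
  have hP0 : P ≠ 0 := by
    intro h0
    rw [h0, ENNReal.zero_rpow_of_pos (by positivity), nonpos_iff_eq_zero] at hLP
    exact hL0 hLP
  -- The function `c v ^ (p - 1)` has unit norm and is extremal in Hölder's inequality against `v`;
  -- its image is almost everywhere `u`.
  set c := P ^ (-(1 / p')) with hc
  have hc0 : c ≠ 0 := by simp [hc, ENNReal.rpow_eq_zero_iff, hP0, hPtop]
  have hctop : c ≠ ∞ := by simp [hc, ENNReal.rpow_eq_top_iff, hP0, hPtop]
  have hψm : Measurable fun x => c * v x ^ (p - 1) := (hvm.pow_const _).const_mul c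
  have hψ1 : ∫⁻ x, (c * v x ^ (p - 1)) ^ p' ∂μ ≤ 1 := by
    have e : ∀ x, (c * v x ^ (p - 1)) ^ p' = P⁻¹ * v x ^ p := by
      intro x
      rw [ENNReal.mul_rpow_of_nonneg _ _ hp'0.le, hc, ← ENNReal.rpow_mul, ← ENNReal.rpow_mul,
        hpp.sub_one_mul_conj, neg_mul, one_div, inv_mul_cancel₀ hp'0.ne', ENNReal.rpow_neg_one]
    simp_rw [e]
    rw [lintegral_const_mul _ (hvm.pow_const p), ENNReal.inv_mul_cancel hP0 hPtop]
  have hmul : L ≤ ∫⁻ y, u y ^ (q - 1) * K (fun x => c * v x ^ (p - 1)) y ∂ν := by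
    rw [← hswap _ hψm]
    have e : ∀ x, v x * (c * v x ^ (p - 1)) = c * v x ^ p := by
      intro x
      rw [← hpow' (v x)]
      ring
    simp_rw [e]
    rw [lintegral_const_mul _ (hvm.pow_const p)]
    refine hLP.trans_eq ?_
    have e2 : 1 / p = -(1 / p') + 1 := by
      have := hpp.inv_add_inv_eq_one
      rw [one_div, one_div]
      linarith
    rw [e2, ENNReal.rpow_add _ _ hP0 hPtop, ENNReal.rpow_one]
  have hae := ae_eq_of_lintegral_rpow_le hq (hKm _ hψm) hum (huq ▸ hLtop)
    ((hLle _ hψm hψ1).trans_eq huq.symm) (huq.trans_le hmul)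
  refine ⟨K (fun x => c * v x ^ (p - 1)), v, c, max A C, hKm _ hψm, hvm, hc0, hctop,
    by simp [hAtop, hCtop], fun y => ?_, fun x => ?_, fun y => ?_, fun x => ?_, ?_, hP0⟩
  · have hm : Measurable fun x => k x y * v x ^ (p - 1) := (hmk y).mul (hvm.pow_const _)
    refine Eq.trans (lintegral_congr fun x => ?_) (lintegral_const_mul c hm)
    ring
  · refine lintegral_congr_ae ?_
    filter_upwards [hae] with y hy
    rw [hy]
  · exact (hKle _ hψm hψ1 y).trans (by gcongr; exact le_max_left _ _)
  · exact (hvle x).trans (by gcongr; exact le_max_right _ _)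
  · rw [lintegral_congr_ae (g := fun y => u y ^ q) (by filter_upwards [hae] with y hy; rw [hy]), huq]
    exact hL0

/-! ### The punctured ball and its cutoff functions -/

/-- The ball of radius `R` about the origin, with the origin removed. -/
def puncturedBall (n : ℕ) (R : ℝ) : Set (EuclideanSpace ℝ (Fin n)) := Metric.ball 0 R \ {0}

theorem mem_puncturedBall {n : ℕ} {R : ℝ} {x : EuclideanSpace ℝ (Fin n)} :
    x ∈ puncturedBall n R ↔ 0 < ‖x‖ ∧ ‖x‖ < R := by
  simp [puncturedBall, and_comm]

theorem isOpen_puncturedBall (n : ℕ) (R : ℝ) : IsOpen (puncturedBall n R) :=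
  Metric.isOpen_ball.sdiff isClosed_singleton

theorem coe_originBall (n : ℕ) (R : ℝ) :
    (originBall n R : Set (EuclideanSpace ℝ (Fin n))) = Metric.ball 0 R := rfl

theorem ae_restrict_mem_puncturedBall {n : ℕ} (hn : 1 ≤ n) (R : ℝ) :
    ∀ᵐ x : EuclideanSpace ℝ (Fin n) ∂volume.restrict (Metric.ball 0 R),
      x ∈ puncturedBall n R := by
  have : Nonempty (Fin n) := ⟨⟨0, hn⟩⟩
  have h : ∀ᵐ x : EuclideanSpace ℝ (Fin n), x ≠ 0 := by
    rw [ae_iff]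
    simp
  filter_upwards [ae_restrict_mem measurableSet_ball, ae_restrict_of_ae h] with x h1 h2
  exact ⟨h1, h2⟩

/-- A function on the ball, continuous off the origin, is integrable if it is `O(|x|^(-s))` with
`s < n`. -/
theorem integrableOn_ball_of_le_rpow {n : ℕ} (hn : 1 ≤ n) {R C s : ℝ} (hs : s < n)
    {f : EuclideanSpace ℝ (Fin n) → ℝ} (hf : ContinuousOn f (puncturedBall n R))
    (hle : ∀ x ∈ puncturedBall n R, |f x| ≤ C * ‖x‖ ^ (-s)) :
    IntegrableOn f (Metric.ball 0 R) := by
  have hae := ae_restrict_mem_puncturedBall hn R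
  have hm := (isOpen_puncturedBall n R).measurableSet
  have h := integrableOn_ball_of_norm_le_rpow (μ := volume) (r := R) (C := C) (α := s)
    (f := (puncturedBall n R).indicator f) (by simpa using hn) (by simpa using hs)
    (by
      filter_upwards [hae] with x hx
      rw [Set.indicator_of_mem hx]
      exact hle x hx)
    ((aestronglyMeasurable_indicator_iff hm).2 (hf.aestronglyMeasurable hm))
  refine IntegrableOn.congr_fun_ae h ?_
  filter_upwards [hae] with x hx
  rw [Set.indicator_of_mem hx]

/-- The partial derivative of a test function, as a test function. -/
noncomputable def partialTest {n : ℕ} {Ω : Opens (EuclideanSpace ℝ (Fin n))} (i : Fin n) (φ : 𝓓(Ω, ℝ)) :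
    𝓓(Ω, ℝ) where
  toFun := partialDeriv i φ
  contDiff' := (φ.contDiff.fderiv_right (m := ((⊤ : ℕ∞) : WithTop ℕ∞)) le_rfl).clm_apply
    contDiff_const
  hasCompactSupport' := φ.hasCompactSupport.fderiv_apply ℝ _
  tsupport_subset' := (tsupport_fderiv_apply_subset ℝ _).trans φ.tsupport_subset

theorem coe_partialTest {n : ℕ} {Ω : Opens (EuclideanSpace ℝ (Fin n))} (i : Fin n)
    (φ : 𝓓(Ω, ℝ)) : ⇑(partialTest i φ) = partialDeriv i φ := rfl

theorem partialDeriv_mul {n : ℕ} (i : Fin n) {f g : EuclideanSpace ℝ (Fin n) → ℝ}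
    {x : EuclideanSpace ℝ (Fin n)} (hf : DifferentiableAt ℝ f x) (hg : DifferentiableAt ℝ g x) :
    partialDeriv i (fun y => f y * g y) x = f x * partialDeriv i g x + g x * partialDeriv i f x := by
  simp [partialDeriv, fderiv_fun_mul hf hg]

theorem laplacian_eq_sum_partialDeriv {n : ℕ} {Ω : Opens (EuclideanSpace ℝ (Fin n))}
    (φ : 𝓓(Ω, ℝ)) (x : EuclideanSpace ℝ (Fin n)) :
    Laplacian.laplacian (φ : _ → ℝ) x = ∑ i, partialDeriv i (partialDeriv i φ) x := by
  have h := congrFun (InnerProductSpace.laplacian_eq_iteratedFDeriv_orthonormalBasis (φ : _ → ℝ)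
    (EuclideanSpace.basisFun (Fin n) ℝ)) x
  refine h.trans (Finset.sum_congr rfl fun i _ => ?_)
  rw [iteratedFDeriv_two_apply]
  have hd : DifferentiableAt ℝ (fderiv ℝ φ) x :=
    ((φ.contDiff.fderiv_right (m := ((⊤ : ℕ∞) : WithTop ℕ∞)) le_rfl).differentiable (by simp)) x
  unfold partialDeriv
  rw [fderiv_clm_apply hd (differentiableAt_const _)]
  simp

/-- A defining function of the punctured ball: positive on it, and nonpositive elsewhere. -/
noncomputable def punctureFun (n : ℕ) (R : ℝ) (x : EuclideanSpace ℝ (Fin n)) : ℝ :=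
  ‖x‖ ^ 2 * (R ^ 2 - ‖x‖ ^ 2)

/-- A smooth cutoff vanishing near the origin and near the complement of the ball. -/
noncomputable def cutoff (n : ℕ) (R : ℝ) (k : ℕ) (x : EuclideanSpace ℝ (Fin n)) : ℝ :=
  Real.smoothTransition (k * punctureFun n R x - 1)

theorem contDiff_punctureFun (n : ℕ) (R : ℝ) {m : WithTop ℕ∞} : ContDiff ℝ m (punctureFun n R) :=
  (contDiff_norm_sq ℝ).mul (contDiff_const.sub (contDiff_norm_sq ℝ))

theorem punctureFun_pos {n : ℕ} {R : ℝ} {x : EuclideanSpace ℝ (Fin n)}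
    (hx : x ∈ puncturedBall n R) : 0 < punctureFun n R x := by
  obtain ⟨h1, h2⟩ := mem_puncturedBall.1 hx
  have : 0 < R ^ 2 - ‖x‖ ^ 2 := by nlinarith
  unfold punctureFun
  positivity

theorem mem_puncturedBall_of_punctureFun_pos {n : ℕ} {R : ℝ} (hR : 0 < R)
    {x : EuclideanSpace ℝ (Fin n)} (hx : 0 < punctureFun n R x) : x ∈ puncturedBall n R := by
  rw [mem_puncturedBall]
  unfold punctureFun at hx
  have h0 : 0 < ‖x‖ := by
    rcases (norm_nonneg x).eq_or_lt with h | h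
    · rw [← h] at hx; simp at hx
    · exact h
  refine ⟨h0, ?_⟩
  by_contra! h
  have : ‖x‖ ^ 2 * (R ^ 2 - ‖x‖ ^ 2) ≤ 0 := mul_nonpos_of_nonneg_of_nonpos (by positivity) (by nlinarith)
  linarith

theorem partialDeriv_punctureFun {n : ℕ} (R : ℝ) (i : Fin n) (x : EuclideanSpace ℝ (Fin n)) :
    partialDeriv i (punctureFun n R) x = 2 * x i * (R ^ 2 - 2 * ‖x‖ ^ 2) := by
  have h1 := (hasStrictFDerivAt_norm_sq x).hasFDerivAt
  have h : HasFDerivAt (punctureFun n R) _ x := h1.mul (h1.const_sub (R ^ 2))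
  rw [partialDeriv, h.fderiv]
  simp [EuclideanSpace.inner_single_right]
  ring

theorem abs_partialDeriv_punctureFun_le {n : ℕ} {R : ℝ} (i : Fin n)
    {x : EuclideanSpace ℝ (Fin n)} (hx : x ∈ puncturedBall n R) :
    |partialDeriv i (punctureFun n R) x| ≤ 2 * R ^ 2 * ‖x‖ := by
  obtain ⟨h1, h2⟩ := mem_puncturedBall.1 hx
  rw [partialDeriv_punctureFun, abs_mul, abs_mul]
  have h3 : |x i| ≤ ‖x‖ := by simpa using PiLp.norm_apply_le x i
  have h4 : |R ^ 2 - 2 * ‖x‖ ^ 2| ≤ R ^ 2 := by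
    rw [abs_le]; constructor <;> nlinarith
  calc |(2:ℝ)| * |x i| * |R ^ 2 - 2 * ‖x‖ ^ 2| ≤ 2 * ‖x‖ * R ^ 2 := by
        rw [abs_two]; gcongr
    _ = _ := by ring

theorem exists_abs_deriv_smoothTransition_le :
    ∃ M : ℝ, 0 ≤ M ∧ (∀ t, |deriv Real.smoothTransition t| ≤ M) ∧
      ∀ t, 1 < t → deriv Real.smoothTransition t = 0 := by
  have hcont : Continuous (deriv Real.smoothTransition) :=
    (Real.smoothTransition.contDiff (n := 1)).continuous_deriv le_rfl
  have h1 : ∀ t, 1 < t → deriv Real.smoothTransition t = 0 := by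
    intro t ht
    have : Real.smoothTransition =ᶠ[𝓝 t] fun _ => 1 := by
      filter_upwards [lt_mem_nhds ht] with s hs using Real.smoothTransition.one_of_one_le hs.le
    rw [this.deriv_eq, deriv_const]
  have h0 : ∀ t, t < 0 → deriv Real.smoothTransition t = 0 := by
    intro t ht
    have : Real.smoothTransition =ᶠ[𝓝 t] fun _ => 0 := by
      filter_upwards [gt_mem_nhds ht] with s hs using Real.smoothTransition.zero_of_nonpos hs.le
    rw [this.deriv_eq, deriv_const]
  obtain ⟨M, hM⟩ := (isCompact_Icc (a := (0:ℝ)) (b := 1)).exists_bound_of_continuousOn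
    hcont.continuousOn
  refine ⟨M, (norm_nonneg _).trans (hM 0 (by simp)), fun t => ?_, h1⟩
  by_cases ht : t ∈ Set.Icc (0:ℝ) 1
  · exact hM t ht
  · have hM0 := (norm_nonneg _).trans (hM 0 (by simp))
    simp only [Set.mem_Icc, not_and_or, not_le] at ht
    rcases ht with ht | ht
    · simpa [h0 t ht] using hM0
    · simpa [h1 t ht] using hM0

theorem contDiff_cutoff (n : ℕ) (R : ℝ) (k : ℕ) {m : ℕ∞} : ContDiff ℝ m (cutoff n R k) :=
  Real.smoothTransition.contDiff.comp
    ((contDiff_const.mul (contDiff_punctureFun n R)).sub contDiff_const)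

theorem abs_cutoff_le_one (n : ℕ) (R : ℝ) (k : ℕ) (x : EuclideanSpace ℝ (Fin n)) :
    |cutoff n R k x| ≤ 1 := by
  rw [cutoff, abs_of_nonneg (Real.smoothTransition.nonneg _)]
  exact Real.smoothTransition.le_one _

theorem tsupport_cutoff_subset (n : ℕ) {R : ℝ} (hR : 0 < R) (k : ℕ) :
    tsupport (cutoff n R k) ⊆ puncturedBall n R := by
  have h1 : tsupport (cutoff n R k) ⊆ {x | 1 ≤ k * punctureFun n R x} := by
    refine closure_minimal ?_ (isClosed_le continuous_const
      (continuous_const.mul (contDiff_punctureFun n R (m := 0)).continuous))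
    intro x hx
    by_contra h
    simp only [Set.mem_ofPred_eq, not_le] at h
    exact hx (Real.smoothTransition.zero_of_nonpos (by linarith))
  intro x hx
  refine mem_puncturedBall_of_punctureFun_pos hR ?_
  have h2 : 1 ≤ k * punctureFun n R x := h1 hx
  by_contra! h
  have : (k : ℝ) * punctureFun n R x ≤ 0 := mul_nonpos_of_nonneg_of_nonpos (by positivity) h
  linarith

theorem hasCompactSupport_cutoff (n : ℕ) {R : ℝ} (hR : 0 < R) (k : ℕ) :
    HasCompactSupport (cutoff n R k) := by
  refine Metric.isCompact_of_isClosed_isBounded (isClosed_tsupport _)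
    (Metric.isBounded_ball (x := 0) (r := R) |>.subset ?_)
  exact (tsupport_cutoff_subset n hR k).trans Set.sdiff_subset

theorem eventually_cutoff_eq_one {n : ℕ} {R : ℝ} {x : EuclideanSpace ℝ (Fin n)}
    (hx : x ∈ puncturedBall n R) :
    ∀ᶠ k in atTop, cutoff n R k x = 1 ∧ ∀ i, partialDeriv i (cutoff n R k) x = 0 := by
  have hd := punctureFun_pos hx
  have ht : Tendsto (fun k : ℕ => (k : ℝ) * punctureFun n R x) atTop atTop :=
    tendsto_natCast_atTop_atTop.atTop_mul_const hd
  filter_upwards [ht.eventually_gt_atTop 2] with k hk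
  have hev : cutoff n R k =ᶠ[𝓝 x] fun _ => 1 := by
    have hc : ContinuousAt (fun y => (k : ℝ) * punctureFun n R y) x :=
      (continuous_const.mul (contDiff_punctureFun n R (m := 0)).continuous).continuousAt
    filter_upwards [hc.eventually (lt_mem_nhds hk)] with y hy
    exact Real.smoothTransition.one_of_one_le (by linarith)
  refine ⟨hev.self_of_nhds, fun i => ?_⟩
  rw [partialDeriv, hev.fderiv_eq]
  simp

/-- The gradients of the cutoffs are bounded, uniformly in `k`, by a multiple of the inverse
distance to the boundary of the punctured ball. -/
theorem exists_abs_partialDeriv_cutoff_le (n : ℕ) {R : ℝ} :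
    ∃ M : ℝ, 0 ≤ M ∧ ∀ k i, ∀ x ∈ puncturedBall n R,
      |partialDeriv i (cutoff n R k) x| ≤ M / (‖x‖ * (R ^ 2 - ‖x‖ ^ 2)) := by
  obtain ⟨M, hM0, hM, hM1⟩ := exists_abs_deriv_smoothTransition_le
  refine ⟨M * 2 * (2 * R ^ 2), by positivity, fun k i x hx => ?_⟩
  obtain ⟨h1, h2⟩ := mem_puncturedBall.1 hx
  have h3 : 0 < R ^ 2 - ‖x‖ ^ 2 := by nlinarith
  have hd := punctureFun_pos hx
  have hder : partialDeriv i (cutoff n R k) x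
      = deriv Real.smoothTransition (k * punctureFun n R x - 1)
        * (k * partialDeriv i (punctureFun n R) x) := by
    have e1 : HasFDerivAt (punctureFun n R) (fderiv ℝ (punctureFun n R) x) x :=
      ((contDiff_punctureFun n R (m := 1)).differentiable (by simp) x).hasFDerivAt
    have e2 := (e1.const_mul (k : ℝ)).sub_const 1
    have e3 : HasDerivAt Real.smoothTransition _ (k * punctureFun n R x - 1) :=
      ((Real.smoothTransition.contDiff (n := 1)).differentiable (by simp) _).hasDerivAt
    have e4 : HasFDerivAt (cutoff n R k) _ x := e3.comp_hasFDerivAt x e2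
    rw [partialDeriv, e4.fderiv]
    simp [partialDeriv]
  rw [hder, abs_mul]
  -- The derivative of the transition function is supported where `k` is at most `2 / punctureFun`.
  by_cases hk : 1 < k * punctureFun n R x - 1
  · rw [hM1 _ hk, abs_zero, zero_mul]
    positivity
  · rw [not_lt] at hk
    have hk2 : (k : ℝ) ≤ 2 / punctureFun n R x := by
      rw [le_div_iff₀ hd]; linarith
    rw [abs_mul, Nat.abs_cast]
    calc _ ≤ M * (2 / punctureFun n R x * (2 * R ^ 2 * ‖x‖)) := by
          gcongr
          · exact hM _
          · exact abs_partialDeriv_punctureFun_le i hx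
      _ = _ := by
          unfold punctureFun
          field_simp

/-! ### Weak derivatives across a point singularity, and mollification -/

theorem integrable_mul_of_tsupport_subset {E : Type*} [TopologicalSpace E] [MeasurableSpace E]
    [OpensMeasurableSpace E] {μ : Measure E} {B : Set E} {H ψ : E → ℝ} (hH : IntegrableOn H B μ)
    (hψ : Continuous ψ) (hc : HasCompactSupport ψ) (hsub : tsupport ψ ⊆ B) :
    Integrable (fun x => H x * ψ x) μ ∧ ∫ x in B, H x * ψ x ∂μ = ∫ x, H x * ψ x ∂μ := by
  obtain ⟨c, hcb⟩ := hψ.bounded_above_of_compact_support hc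
  have h0 : ∀ x, x ∉ B → H x * ψ x = 0 := fun x hx => by
    rw [image_eq_zero_of_notMem_tsupport fun h => hx (hsub h), mul_zero]
  constructor
  · rw [← integrableOn_iff_integrable_of_support_subset (s := B)]
    · exact Integrable.mul_bdd (c := c) hH hψ.aestronglyMeasurable (ae_of_all _ hcb)
    · intro x hx
      by_contra h
      exact hx (h0 x h)
  · exact setIntegral_eq_integral_of_forall_compl_eq_zero h0

theorem continuousOn_partialDeriv {n : ℕ} {F : EuclideanSpace ℝ (Fin n) → ℝ}
    {U : Set (EuclideanSpace ℝ (Fin n))} (hU : IsOpen U) (hF : ContDiffOn ℝ 1 F U) (i : Fin n) :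
    ContinuousOn (partialDeriv i F) U :=
  (hF.continuousOn_fderiv_of_isOpen hU le_rfl).clm_apply continuousOn_const

/-- A test function vanishes near the sphere, so it absorbs the blow-up there of the cutoff
gradients. -/
theorem exists_abs_testFunction_le {n : ℕ} {R : ℝ} (φ : 𝓓(originBall n R, ℝ)) :
    ∃ c : ℝ, 0 ≤ c ∧ ∀ x ∈ puncturedBall n R, |φ x| ≤ c * (R ^ 2 - ‖x‖ ^ 2) := by
  have hpos : ∀ x ∈ tsupport φ, 0 < R ^ 2 - ‖x‖ ^ 2 := by
    intro x hx
    have h : ‖x‖ < R := by simpa [coe_originBall] using φ.tsupport_subset hx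
    nlinarith [norm_nonneg x]
  obtain ⟨c, hc⟩ := φ.hasCompactSupport.isCompact.exists_bound_of_continuousOn
    (f := fun x => φ x / (R ^ 2 - ‖x‖ ^ 2))
    (φ.continuous.continuousOn.div (by fun_prop) fun x hx => (hpos x hx).ne')
  refine ⟨max c 0, le_max_right _ _, fun x hx => ?_⟩
  obtain ⟨h1, h2⟩ := mem_puncturedBall.1 hx
  have h3 : 0 < R ^ 2 - ‖x‖ ^ 2 := by nlinarith
  by_cases hxs : x ∈ tsupport φ
  · have h := hc x hxs
    rw [norm_div, Real.norm_eq_abs, Real.norm_eq_abs, abs_of_pos h3, div_le_iff₀ h3] at h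
    exact h.trans (by gcongr; exact le_max_left _ _)
  · rw [image_eq_zero_of_notMem_tsupport hxs, abs_zero]
    positivity

/-- The classical gradient off the origin is the weak gradient, as soon as the singularity at the
origin is weak enough for the error terms of a cutoff to vanish in the limit. -/
theorem isWeakPartialDeriv_partialDeriv {n : ℕ} (hn : 1 ≤ n) {R C s : ℝ} (hR : 0 < R) (hs : s < n)
    {F : EuclideanSpace ℝ (Fin n) → ℝ} (hF : ContDiffOn ℝ 1 F (puncturedBall n R))
    (hFle : ∀ x ∈ puncturedBall n R, |F x| ≤ C * ‖x‖ ^ (1 - s)) (i : Fin n)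
    (hDle : ∀ x ∈ puncturedBall n R, |partialDeriv i F x| ≤ C * ‖x‖ ^ (-s)) :
    IsWeakPartialDeriv (originBall n R) i F (partialDeriv i F) := by
  have hopen := isOpen_puncturedBall n R
  have FI : IntegrableOn F (Metric.ball 0 R) :=
    integrableOn_ball_of_le_rpow hn (C := C) (s := s - 1) (by linarith) hF.continuousOn
      (fun x hx => by simpa using hFle x hx)
  have hDc := continuousOn_partialDeriv hopen hF i
  have DI : IntegrableOn (partialDeriv i F) (Metric.ball 0 R) :=
    integrableOn_ball_of_le_rpow hn hs hDc hDle
  have hae := ae_restrict_mem_puncturedBall hn R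
  refine ⟨FI.locallyIntegrableOn, DI.locallyIntegrableOn, fun φ => ?_⟩
  rw [coe_originBall]
  obtain ⟨M, hM0, hM⟩ := exists_abs_partialDeriv_cutoff_le n (R := R)
  obtain ⟨c, hc0, hc⟩ := exists_abs_testFunction_le φ
  obtain ⟨c1, hc1⟩ := φ.continuous.bounded_above_of_compact_support φ.hasCompactSupport
  obtain ⟨c2, hc2⟩ := (partialTest i φ).continuous.bounded_above_of_compact_support
    (partialTest i φ).hasCompactSupport
  have hηd : ∀ k, Differentiable ℝ (cutoff n R k) := fun k =>
    (contDiff_cutoff n R k (m := 1)).differentiable (by simp)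
  have hηc : ∀ k, Continuous (cutoff n R k) := fun k => (hηd k).continuous
  have hη'c : ∀ k, Continuous (partialDeriv i (cutoff n R k)) := fun k =>
    ((contDiff_cutoff n R k (m := 1)).continuous_fderiv (by simp)).clm_apply continuous_const
  have hφd : Differentiable ℝ φ := φ.contDiff.differentiable (by simp)
  have hφ'c : Continuous (partialDeriv i φ) := (partialTest i φ).continuous
  have hPB : puncturedBall n R ⊆ Metric.ball 0 R := Set.sdiff_subset
  have hparts : ∀ k, ∫ x in Metric.ball 0 R, F x * (cutoff n R k x * partialDeriv i φ x
      + φ x * partialDeriv i (cutoff n R k) x)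
      = - ∫ x in Metric.ball 0 R, partialDeriv i F x * (cutoff n R k x * φ x) := by
    intro k
    have hts : tsupport (fun x => cutoff n R k x * φ x) ⊆ puncturedBall n R :=
      (tsupport_mul_subset_left).trans (tsupport_cutoff_subset n hR k)
    have hcs : HasCompactSupport (fun x => cutoff n R k x * φ x) :=
      (hasCompactSupport_cutoff n hR k).mul_right
    have hgc : Continuous (fun x => cutoff n R k x * φ x) := (hηc k).mul φ.continuous
    have hg' : ∀ x, fderiv ℝ (fun x => cutoff n R k x * φ x) x (EuclideanSpace.single i 1)
        = cutoff n R k x * partialDeriv i φ x + φ x * partialDeriv i (cutoff n R k) x :=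
      fun x => partialDeriv_mul i (hηd k x) (hφd x)
    have hg'c : Continuous fun x => fderiv ℝ (fun x => cutoff n R k x * φ x) x
        (EuclideanSpace.single i 1) := by
      simp_rw [hg']
      exact ((hηc k).mul hφ'c).add (φ.continuous.mul (hη'c k))
    have hg's : tsupport (fun x => fderiv ℝ (fun x => cutoff n R k x * φ x) x
        (EuclideanSpace.single i 1)) ⊆ puncturedBall n R :=
      (tsupport_fderiv_apply_subset ℝ _).trans hts
    have I1 := integrable_mul_of_tsupport_subset DI hgc hcs (hts.trans hPB)
    have I2 := integrable_mul_of_tsupport_subset FI hgc hcs (hts.trans hPB)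
    have I3 := integrable_mul_of_tsupport_subset FI hg'c (hcs.fderiv_apply ℝ _) (hg's.trans hPB)
    have h := integral_mul_fderiv_eq_neg_fderiv_mul_of_integrable (μ := volume)
      (f := F) (g := fun x => cutoff n R k x * φ x) (v := EuclideanSpace.single i 1)
      I1.1 I3.1 I2.1
      (fun x hx => (hF.contDiffAt (hopen.mem_nhds (hts hx))).differentiableAt (by simp))
      (fun x _ => (hηd k x).mul (hφd x))
    simp_rw [← hg']
    rw [I3.2, I1.2]
    exact h
  -- The terms with a differentiated cutoff are `O(|x|^(1-s) / |x|)` and tend to zero pointwise.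
  have L1 : Tendsto (fun k => ∫ x in Metric.ball 0 R, F x * (cutoff n R k x * partialDeriv i φ x
      + φ x * partialDeriv i (cutoff n R k) x)) atTop
      (𝓝 (∫ x in Metric.ball 0 R, F x * partialDeriv i φ x)) := by
    have hbI : IntegrableOn (fun x : EuclideanSpace ℝ (Fin n) => C * c * M * ‖x‖ ^ (-s))
        (Metric.ball 0 R) := by
      refine integrableOn_ball_of_le_rpow hn hs (C := |C * c * M|) ?_ fun x hx => ?_
      · refine continuousOn_const.mul (continuousOn_id.norm.rpow_const fun x hx => Or.inl ?_)
        exact (mem_puncturedBall.1 hx).1.ne'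
      · rw [abs_mul, abs_of_nonneg (Real.rpow_nonneg (norm_nonneg _) _)]
    refine tendsto_integral_of_dominated_convergence
      (fun x => |F x| * c2 + C * c * M * ‖x‖ ^ (-s)) (fun k => ?_)
      ((FI.norm.mul_const c2).add hbI) (fun k => ?_) ?_
    · exact FI.aestronglyMeasurable.mul
        (((hηc k).mul hφ'c).add (φ.continuous.mul (hη'c k))).aestronglyMeasurable
    · filter_upwards [hae] with x hx
      obtain ⟨h1, h2⟩ := mem_puncturedBall.1 hx
      have h3 : 0 < R ^ 2 - ‖x‖ ^ 2 := by nlinarith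
      have b1 : |cutoff n R k x * partialDeriv i φ x| ≤ c2 := by
        rw [abs_mul]
        exact (mul_le_of_le_one_left (abs_nonneg _) (abs_cutoff_le_one n R k x)).trans (hc2 x)
      have b2 : |φ x * partialDeriv i (cutoff n R k) x| ≤ c * M * ‖x‖⁻¹ := by
        rw [abs_mul]
        calc _ ≤ (c * (R ^ 2 - ‖x‖ ^ 2)) * (M / (‖x‖ * (R ^ 2 - ‖x‖ ^ 2))) := by
              gcongr
              · exact hc x hx
              · exact hM k i x hx
          _ = _ := by field_simp
      rw [Real.norm_eq_abs, mul_add]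
      refine (abs_add_le _ _).trans (add_le_add ?_ ?_)
      · rw [abs_mul]; gcongr
      · rw [abs_mul]
        calc _ ≤ (C * ‖x‖ ^ (1 - s)) * (c * M * ‖x‖⁻¹) := by
              gcongr
              · exact (abs_nonneg _).trans (hFle x hx)
              · exact hFle x hx
          _ = C * c * M * (‖x‖ ^ (1 - s) * ‖x‖⁻¹) := by ring
          _ = _ := by rw [← Real.rpow_neg_one ‖x‖, ← Real.rpow_add h1]; ring_nf
    · filter_upwards [hae] with x hx
      refine tendsto_const_nhds.congr' ?_
      filter_upwards [eventually_cutoff_eq_one hx] with k hk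
      rw [hk.1, hk.2 i]
      ring
  have L2 : Tendsto (fun k => - ∫ x in Metric.ball 0 R, partialDeriv i F x * (cutoff n R k x * φ x))
      atTop (𝓝 (- ∫ x in Metric.ball 0 R, partialDeriv i F x * φ x)) := by
    refine (tendsto_integral_of_dominated_convergence
      (fun x => |partialDeriv i F x| * c1) (fun k => ?_) (DI.norm.mul_const c1)
      (fun k => ?_) ?_).neg
    · exact DI.aestronglyMeasurable.mul ((hηc k).mul φ.continuous).aestronglyMeasurable
    · refine ae_of_all _ fun x => ?_
      rw [Real.norm_eq_abs, abs_mul, abs_mul]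
      gcongr
      exact (mul_le_of_le_one_left (abs_nonneg _) (abs_cutoff_le_one n R k x)).trans (hc1 x)
    · filter_upwards [hae] with x hx
      refine tendsto_const_nhds.congr' ?_
      filter_upwards [eventually_cutoff_eq_one hx] with k hk
      rw [hk.1, one_mul]
  exact tendsto_nhds_unique (L1.congr hparts) L2

/-- Mollification: a compactly supported `C¹` function is a `C¹`-uniform limit of test functions. -/
theorem exists_testFunction_near {n : ℕ} {Ω : Opens (EuclideanSpace ℝ (Fin n))}
    {w : EuclideanSpace ℝ (Fin n) → ℝ} (hw : ContDiff ℝ 1 w) (hc : HasCompactSupport w)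
    (hsub : tsupport w ⊆ Ω) {ε : ℝ} (hε : 0 < ε) :
    ∃ φ : 𝓓(Ω, ℝ), (∀ x, |w x - φ x| ≤ ε) ∧
      ∀ i x, |partialDeriv i w x - partialDeriv i φ x| ≤ ε := by
  obtain ⟨δ, hδ, hδΩ⟩ := hc.isCompact.exists_cthickening_subset_open Ω.isOpen hsub
  have hw'c : Continuous (fderiv ℝ w) := hw.continuous_fderiv (by simp)
  obtain ⟨δ1, hδ1, h1⟩ := Metric.uniformContinuous_iff.1
    (hc.uniformContinuous_of_continuous hw.continuous) ε hε
  obtain ⟨δ2, hδ2, h2⟩ := Metric.uniformContinuous_iff.1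
    ((hc.fderiv ℝ).uniformContinuous_of_continuous hw'c) ε hε
  set r := min δ (min δ1 δ2) with hr
  have hr0 : 0 < r := by positivity
  let ψ : ContDiffBump (0 : EuclideanSpace ℝ (Fin n)) := ⟨r / 2, r, by positivity, by linarith⟩
  have hψr : ψ.rOut = r := rfl
  set L := ContinuousLinearMap.lsmul ℝ ℝ (E := ℝ) with hL
  have hψint : LocallyIntegrable (ψ.normed volume) (volume : Measure (EuclideanSpace ℝ (Fin n))) :=
    (ψ.continuous_normed).locallyIntegrable
  have hsm : ContDiff ℝ ((⊤ : ℕ∞) : WithTop ℕ∞) (convolution (ψ.normed volume) w L volume) :=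
    ψ.hasCompactSupport_normed.contDiff_convolution_left L ψ.contDiff_normed
      hw.continuous.locallyIntegrable
  have hsupp : tsupport (convolution (ψ.normed volume) w L volume) ⊆ Ω := by
    refine subset_trans (closure_minimal ?_ Metric.isClosed_cthickening) hδΩ
    refine (support_convolution_subset_swap L).trans ?_
    rintro x ⟨y, hy, z, hz, rfl⟩
    rw [ψ.support_normed_eq, hψr, mem_ball_zero_iff] at hz
    refine Metric.mem_cthickening_of_dist_le _ y _ _ (subset_tsupport _ hy) ?_
    rw [dist_eq_norm, add_sub_cancel_left]
    exact hz.le.trans (min_le_left _ _)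
  refine ⟨⟨_, hsm, ψ.hasCompactSupport_normed.convolution L hc, hsupp⟩, fun x => ?_,
    fun i x => ?_⟩
  · rw [TestFunction.coe_mk, abs_sub_comm, ← Real.dist_eq]
    refine ψ.dist_normed_convolution_le hw.continuous.aestronglyMeasurable fun y hy => ?_
    exact (h1 (lt_of_lt_of_le (Metric.mem_ball.1 hy) (by
      rw [hψr]; exact (min_le_right _ _).trans (min_le_left _ _)))).le
  · have hd := (hc.hasFDerivAt_convolution_right L hψint hw x).fderiv
    rw [TestFunction.coe_mk, partialDeriv, partialDeriv, hd,
      convolution_precompR_apply L hψint (hc.fderiv ℝ) hw'c, abs_sub_comm, ← Real.dist_eq]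
    refine ψ.dist_normed_convolution_le (g := fun a => fderiv ℝ w a (EuclideanSpace.single i 1))
      (hw'c.clm_apply continuous_const).aestronglyMeasurable fun y hy => ?_
    have h3 := (h2 (lt_of_lt_of_le (Metric.mem_ball.1 hy) (by
      rw [hψr]; exact (min_le_right _ _).trans (min_le_right _ _)))).le
    rw [dist_eq_norm] at h3 ⊢
    refine le_trans ?_ h3
    simpa using (fderiv ℝ w y - fderiv ℝ w x).le_opNorm (EuclideanSpace.single i 1)

/-! ### Sobolev spaces and the distributional Laplacian -/

/-- A `C¹` function on the punctured ball that vanishes linearly at the boundary sphere belongs to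
`W^{1,1}_0`: cut it off and mollify. -/
theorem memSobolevZero_of_puncturedBall {n : ℕ} (hn : 1 ≤ n) {R C s : ℝ} (hR : 0 < R) (hs : s < n)
    (hC : 0 ≤ C) {F : EuclideanSpace ℝ (Fin n) → ℝ} (hF : ContDiffOn ℝ 1 F (puncturedBall n R))
    (hFle : ∀ x ∈ puncturedBall n R, |F x| ≤ C * ‖x‖ ^ (1 - s) * (R ^ 2 - ‖x‖ ^ 2))
    (hDle : ∀ i, ∀ x ∈ puncturedBall n R, |partialDeriv i F x| ≤ C * ‖x‖ ^ (-s)) :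
    MemSobolevZero (originBall n R) 1 F := by
  have hopen := isOpen_puncturedBall n R
  have hPB : puncturedBall n R ⊆ Metric.ball 0 R := Set.sdiff_subset
  have hae := ae_restrict_mem_puncturedBall hn R
  have hFle' : ∀ x ∈ puncturedBall n R, |F x| ≤ C * max (R ^ 2) 1 * ‖x‖ ^ (1 - s) := by
    intro x hx
    refine (hFle x hx).trans ?_
    calc _ ≤ C * ‖x‖ ^ (1 - s) * max (R ^ 2) 1 := by
          gcongr
          exact (sub_le_self _ (by positivity)).trans (le_max_left _ _)
      _ = _ := by ring
  have hDle' : ∀ i, ∀ x ∈ puncturedBall n R,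
      |partialDeriv i F x| ≤ C * max (R ^ 2) 1 * ‖x‖ ^ (-s) := by
    intro i x hx
    refine (hDle i x hx).trans ?_
    gcongr
    exact le_mul_of_one_le_right hC (le_max_right _ _)
  have FI : IntegrableOn F (Metric.ball 0 R) :=
    integrableOn_ball_of_le_rpow hn (s := s - 1) (by linarith) hF.continuousOn
      (fun x hx => by simpa using hFle' x hx)
  have DI : ∀ i, IntegrableOn (partialDeriv i F) (Metric.ball 0 R) := fun i =>
    integrableOn_ball_of_le_rpow hn hs (continuousOn_partialDeriv hopen hF i) (hDle i)
  obtain ⟨M, hM0, hM⟩ := exists_abs_partialDeriv_cutoff_le n (R := R)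
  have hηd : ∀ k, Differentiable ℝ (cutoff n R k) := fun k =>
    (contDiff_cutoff n R k (m := 1)).differentiable (by simp)
  have hηc : ∀ k, Continuous (cutoff n R k) := fun k => (hηd k).continuous
  have hη'c : ∀ k i, Continuous (partialDeriv i (cutoff n R k)) := fun k i =>
    ((contDiff_cutoff n R k (m := 1)).continuous_fderiv (by simp)).clm_apply continuous_const
  have hts : ∀ k, tsupport (fun x => cutoff n R k x * F x) ⊆ puncturedBall n R := fun k =>
    (tsupport_mul_subset_left).trans (tsupport_cutoff_subset n hR k)
  have hcs : ∀ k, HasCompactSupport (fun x => cutoff n R k x * F x) := fun k =>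
    (hasCompactSupport_cutoff n hR k).mul_right
  have hw : ∀ k, ContDiff ℝ 1 (fun x => cutoff n R k x * F x) := by
    intro k
    rw [contDiff_iff_contDiffAt]
    intro x
    by_cases hx : x ∈ tsupport (fun x => cutoff n R k x * F x)
    · exact (contDiff_cutoff n R k (m := 1)).contDiffAt.mul
        (hF.contDiffAt (hopen.mem_nhds (hts k hx)))
    · exact contDiffAt_const.congr_of_eventuallyEq (notMem_tsupport_iff_eventuallyEq.1 hx)
  have hw' : ∀ k i, ∀ x ∈ puncturedBall n R, partialDeriv i (fun x => cutoff n R k x * F x) x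
      = cutoff n R k x * partialDeriv i F x + F x * partialDeriv i (cutoff n R k) x :=
    fun k i x hx => partialDeriv_mul i (hηd k x)
      ((hF.contDiffAt (hopen.mem_nhds hx)).differentiableAt (by simp))
  have L0 : Tendsto (fun k => eLpNorm (fun x => F x - cutoff n R k x * F x) 1
      (volume.restrict (Metric.ball 0 R))) atTop (𝓝 0) := by
    have h := tendsto_lintegral_norm_of_dominated_convergence
      (μ := volume.restrict (Metric.ball 0 R)) (F := fun k x => cutoff n R k x * F x) (f := F)
      (bound := fun x => |F x|) (fun k => (hηc k).aestronglyMeasurable.mul FI.aestronglyMeasurable)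
      FI.norm.hasFiniteIntegral (fun k => ae_of_all _ fun x => by
        rw [Real.norm_eq_abs, abs_mul]
        exact mul_le_of_le_one_left (abs_nonneg _) (abs_cutoff_le_one n R k x))
      (by
        filter_upwards [hae] with x hx
        refine tendsto_const_nhds.congr' ?_
        filter_upwards [eventually_cutoff_eq_one hx] with k hk
        rw [hk.1, one_mul])
    refine h.congr fun k => ?_
    rw [eLpNorm_one_eq_lintegral_enorm]
    refine lintegral_congr fun x => ?_
    rw [ofReal_norm, enorm_sub_rev]
  -- The linear decay of `F` at the sphere compensates the cutoff gradients there.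
  have L1 : ∀ i, Tendsto (fun k => eLpNorm (fun x => partialDeriv i F x
      - partialDeriv i (fun x => cutoff n R k x * F x) x) 1
      (volume.restrict (Metric.ball 0 R))) atTop (𝓝 0) := by
    intro i
    have hbI : IntegrableOn (fun x : EuclideanSpace ℝ (Fin n) => C * M * ‖x‖ ^ (-s))
        (Metric.ball 0 R) := by
      refine integrableOn_ball_of_le_rpow hn hs (C := |C * M|) ?_ fun x hx => ?_
      · refine continuousOn_const.mul (continuousOn_id.norm.rpow_const fun x hx => Or.inl ?_)
        exact (mem_puncturedBall.1 hx).1.ne'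
      · rw [abs_mul, abs_of_nonneg (Real.rpow_nonneg (norm_nonneg _) _)]
    have h := tendsto_lintegral_norm_of_dominated_convergence
      (μ := volume.restrict (Metric.ball 0 R))
      (F := fun k x => partialDeriv i (fun x => cutoff n R k x * F x) x) (f := partialDeriv i F)
      (bound := fun x => |partialDeriv i F x| + C * M * ‖x‖ ^ (-s))
      (fun k => (((hw k).continuous_fderiv (by simp)).clm_apply
        continuous_const).aestronglyMeasurable)
      ((DI i).norm.add hbI).hasFiniteIntegral (fun k => by
        filter_upwards [hae] with x hx
        obtain ⟨h1, h2⟩ := mem_puncturedBall.1 hx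
        have h3 : 0 < R ^ 2 - ‖x‖ ^ 2 := by nlinarith
        rw [hw' k i x hx, Real.norm_eq_abs]
        refine (abs_add_le _ _).trans (add_le_add ?_ ?_)
        · rw [abs_mul]
          exact mul_le_of_le_one_left (abs_nonneg _) (abs_cutoff_le_one n R k x)
        · rw [abs_mul]
          calc _ ≤ (C * ‖x‖ ^ (1 - s) * (R ^ 2 - ‖x‖ ^ 2)) * (M / (‖x‖ * (R ^ 2 - ‖x‖ ^ 2))) := by
                gcongr
                · exact hFle x hx
                · exact hM k i x hx
            _ = C * M * (‖x‖ ^ (1 - s) * ‖x‖⁻¹) := by field_simp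
            _ = _ := by rw [← Real.rpow_neg_one ‖x‖, ← Real.rpow_add h1]; ring_nf)
      (by
        filter_upwards [hae] with x hx
        refine tendsto_const_nhds.congr' ?_
        filter_upwards [eventually_cutoff_eq_one hx] with k hk
        rw [hw' k i x hx, hk.1, hk.2 i]
        ring)
    refine h.congr fun k => ?_
    rw [eLpNorm_one_eq_lintegral_enorm]
    refine lintegral_congr fun x => ?_
    rw [ofReal_norm, enorm_sub_rev]
  refine ⟨memLp_one_iff_integrable.2 FI, fun i => partialDeriv i F, fun i =>
    ⟨isWeakPartialDeriv_partialDeriv hn hR hs hF hFle' i (hDle' i),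
      memLp_one_iff_integrable.2 (DI i)⟩, fun ε hε => ?_⟩
  rw [coe_originBall]
  have hε2 : 0 < ε / 2 := ENNReal.half_pos hε.ne'
  obtain ⟨k, hk0, hk1⟩ := ((L0.eventually (gt_mem_nhds hε2)).and
    (eventually_all.2 fun i => (L1 i).eventually (gt_mem_nhds hε2))).exists
  have hvol : volume (Metric.ball (0 : EuclideanSpace ℝ (Fin n)) R) ≠ ∞ := measure_ball_lt_top.ne
  obtain ⟨r, hr, hrε⟩ := ENNReal.exists_nnreal_pos_mul_lt hvol hε2.ne'
  obtain ⟨φ, hφ0, hφ1⟩ := exists_testFunction_near (Ω := originBall n R) (hw k) (hcs k)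
    ((hts k).trans hPB) (NNReal.coe_pos.2 hr)
  have hsmall : ∀ f : EuclideanSpace ℝ (Fin n) → ℝ, (∀ x, |f x| ≤ r) →
      eLpNorm f 1 (volume.restrict (Metric.ball 0 R)) < ε / 2 := by
    intro f hf
    refine lt_of_le_of_lt ?_ hrε
    rw [eLpNorm_one_eq_lintegral_enorm]
    calc _ ≤ ∫⁻ _ in Metric.ball (0 : EuclideanSpace ℝ (Fin n)) R, (r : ℝ≥0∞) := by
          refine lintegral_mono fun x => ?_
          rw [← ofReal_norm, ← ENNReal.ofReal_coe_nnreal]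
          exact ENNReal.ofReal_le_ofReal (hf x)
      _ = _ := by simp
  have htri : ∀ f g h : EuclideanSpace ℝ (Fin n) → ℝ,
      AEStronglyMeasurable f (volume.restrict (Metric.ball 0 R)) → Continuous g → Continuous h →
      eLpNorm (fun x => f x - g x) 1 (volume.restrict (Metric.ball 0 R)) < ε / 2 →
      (∀ x, |g x - h x| ≤ r) →
      eLpNorm (fun x => f x - h x) 1 (volume.restrict (Metric.ball 0 R)) < ε := by
    intro f g h hf hg hh h1 h2
    have e : (fun x => f x - h x) = (fun x => f x - g x) + fun x => g x - h x := by
      ext x; simp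
    rw [e]
    refine (eLpNorm_add_le (hf.sub hg.aestronglyMeasurable)
      (hg.sub hh).aestronglyMeasurable le_rfl).trans_lt ?_
    rw [← ENNReal.add_halves ε]
    exact ENNReal.add_lt_add h1 (hsmall _ h2)
  exact ⟨φ, htri _ _ _ FI.aestronglyMeasurable (hw k).continuous φ.continuous hk0 hφ0,
    fun i => htri _ _ _ (DI i).aestronglyMeasurable
      (((hw k).continuous_fderiv (by simp)).clm_apply continuous_const)
      (partialTest i φ).continuous (hk1 i) (hφ1 i)⟩

theorem contDiffOn_partialDeriv {n : ℕ} {F : EuclideanSpace ℝ (Fin n) → ℝ}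
    {U : Set (EuclideanSpace ℝ (Fin n))} (hU : IsOpen U) (hF : ContDiffOn ℝ 2 F U) (i : Fin n) :
    ContDiffOn ℝ 1 (partialDeriv i F) U :=
  (hF.fderiv_of_isOpen hU (by norm_num)).clm_apply contDiffOn_const

/-- A `C²` function on the punctured ball with suitable growth at the origin lies in `W^{2,1}`, and
its distributional Laplacian is the classical one. -/
theorem memSobolev_two_and_negLaplacianEq {n : ℕ} (hn : 1 ≤ n) {R C κ : ℝ} (hR : 0 < R)
    (hC : 0 ≤ C) (hκ : 0 < κ) {u f : EuclideanSpace ℝ (Fin n) → ℝ}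
    (hu : ContDiffOn ℝ 2 u (puncturedBall n R))
    (hule : ∀ x ∈ puncturedBall n R, |u x| ≤ C * ‖x‖ ^ (2 - n : ℝ) * (R ^ 2 - ‖x‖ ^ 2))
    (hDle : ∀ i, ∀ x ∈ puncturedBall n R, |partialDeriv i u x| ≤ C * ‖x‖ ^ (1 - (n - κ)))
    (hDDle : ∀ i j, ∀ x ∈ puncturedBall n R,
      |partialDeriv j (partialDeriv i u) x| ≤ C * ‖x‖ ^ (-(n - κ)))
    (hf : ∀ x ∈ puncturedBall n R, - ∑ i, partialDeriv i (partialDeriv i u) x = f x) :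
    MemSobolevZero (originBall n R) 1 u ∧ MemSobolev (originBall n R) 1 2 u ∧
      NegLaplacianEq (originBall n R) u f := by
  have hopen := isOpen_puncturedBall n R
  have hae := ae_restrict_mem_puncturedBall hn R
  have hs1 : (n : ℝ) - 1 < n := by linarith
  have hs2 : (n : ℝ) - κ < n := by linarith
  have hu1 : ContDiffOn ℝ 1 u (puncturedBall n R) := hu.of_le (by norm_num)
  have hDle1 : ∀ i, ∀ x ∈ puncturedBall n R,
      |partialDeriv i u x| ≤ C * max (R ^ κ) 1 * ‖x‖ ^ (-((n : ℝ) - 1)) := by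
    intro i x hx
    obtain ⟨h1, h2⟩ := mem_puncturedBall.1 hx
    refine (hDle i x hx).trans ?_
    calc C * ‖x‖ ^ (1 - (n - κ)) = C * (‖x‖ ^ κ * ‖x‖ ^ (-((n : ℝ) - 1))) := by
          rw [← Real.rpow_add h1]; ring_nf
      _ ≤ C * (max (R ^ κ) 1 * ‖x‖ ^ (-((n : ℝ) - 1))) := by
          gcongr
          exact (Real.rpow_le_rpow h1.le h2.le hκ.le).trans (le_max_left _ _)
      _ = _ := by ring
  have hzero : MemSobolevZero (originBall n R) 1 u := by
    refine memSobolevZero_of_puncturedBall hn hR hs1 (C := C * max (R ^ κ) 1) (by positivity) hu1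
      (fun x hx => (hule x hx).trans ?_) hDle1
    obtain ⟨h1, h2⟩ := mem_puncturedBall.1 hx
    have h3 : 0 ≤ R ^ 2 - ‖x‖ ^ 2 := by nlinarith
    rw [show (1 : ℝ) - (n - 1) = 2 - n by ring]
    gcongr
    exact le_mul_of_one_le_right hC (le_max_right _ _)
  have hDw : ∀ i, IsWeakPartialDeriv (originBall n R) i u (partialDeriv i u) := by
    intro i
    refine isWeakPartialDeriv_partialDeriv hn hR hs1 (C := C * max (R ^ κ) 1 * max (R ^ 2) 1) hu1
      (fun x hx => (hule x hx).trans ?_) i fun x hx => (hDle1 i x hx).trans ?_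
    · obtain ⟨h1, h2⟩ := mem_puncturedBall.1 hx
      rw [show (1 : ℝ) - (n - 1) = 2 - n by ring]
      calc C * ‖x‖ ^ (2 - n : ℝ) * (R ^ 2 - ‖x‖ ^ 2)
          ≤ (C * max (R ^ κ) 1) * ‖x‖ ^ (2 - n : ℝ) * max (R ^ 2) 1 := by
            gcongr
            · nlinarith
            · exact le_mul_of_one_le_right hC (le_max_right _ _)
            · exact (sub_le_self _ (by positivity)).trans (le_max_left _ _)
        _ = _ := by ring
    · exact mul_le_mul_of_nonneg_right
        (le_mul_of_one_le_right (by positivity) (le_max_right _ _)) (by positivity)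
  have hDDw : ∀ i j, IsWeakPartialDeriv (originBall n R) j (partialDeriv i u)
      (partialDeriv j (partialDeriv i u)) := fun i j =>
    isWeakPartialDeriv_partialDeriv hn hR hs2 (contDiffOn_partialDeriv hopen hu i)
      (hDle i) j (hDDle i j)
  have uI : IntegrableOn u (Metric.ball 0 R) := memLp_one_iff_integrable.1 hzero.1
  have DI : ∀ i, IntegrableOn (partialDeriv i u) (Metric.ball 0 R) := fun i =>
    integrableOn_ball_of_le_rpow hn hs1 (continuousOn_partialDeriv hopen hu1 i) (hDle1 i)
  have DDI : ∀ i j, IntegrableOn (partialDeriv j (partialDeriv i u)) (Metric.ball 0 R) :=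
    fun i j => integrableOn_ball_of_le_rpow hn hs2
      (continuousOn_partialDeriv hopen (contDiffOn_partialDeriv hopen hu i) j) (hDDle i j)
  refine ⟨hzero, ⟨memLp_one_iff_integrable.2 uI, fun i => ⟨_, hDw i,
    memLp_one_iff_integrable.2 (DI i), fun j => ⟨_, hDDw i j,
      memLp_one_iff_integrable.2 (DDI i j)⟩⟩⟩, ?_⟩
  have hfae : (fun x => - ∑ i, partialDeriv i (partialDeriv i u) x)
      =ᵐ[volume.restrict (Metric.ball 0 R)] f := by
    filter_upwards [hae] with x hx using hf x hx
  have fI : IntegrableOn f (Metric.ball 0 R) :=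
    Integrable.congr (integrable_finsetSum _ fun i _ => DDI i i).neg hfae
  refine ⟨uI.locallyIntegrableOn, fI.locallyIntegrableOn, fun φ => ?_⟩
  have hmulI : ∀ (H : EuclideanSpace ℝ (Fin n) → ℝ) (ψ : 𝓓(originBall n R, ℝ)),
      IntegrableOn H (Metric.ball 0 R) → IntegrableOn (fun x => H x * ψ x) (Metric.ball 0 R) :=
    fun H ψ hH => (integrable_mul_of_tsupport_subset hH ψ.continuous ψ.hasCompactSupport
      ψ.tsupport_subset).1.integrableOn
  simp_rw [laplacian_eq_sum_partialDeriv, Finset.mul_sum]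
  have hsum : ∫ x in Metric.ball 0 R, ∑ i, u x * partialDeriv i (partialDeriv i φ) x
      = ∑ i, ∫ x in Metric.ball 0 R, u x * partialDeriv i (partialDeriv i φ) x :=
    integral_finsetSum _ fun i _ => hmulI u (partialTest i (partialTest i φ)) uI
  rw [coe_originBall, hsum]
  have h1 : ∀ i, ∫ x in Metric.ball 0 R, u x * partialDeriv i (partialDeriv i φ) x
      = ∫ x in Metric.ball 0 R, partialDeriv i (partialDeriv i u) x * φ x := by
    intro i
    have e1 := (hDw i).2.2 (partialTest i φ)
    have e2 := (hDDw i i).2.2 φ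
    rw [coe_originBall] at e1 e2
    rw [coe_partialTest] at e1
    rw [e1, e2, neg_neg]
  simp_rw [h1]
  rw [← integral_finsetSum _ fun i _ => hmulI _ φ (DDI i i), ← integral_neg]
  refine integral_congr_ae ?_
  filter_upwards [hfae] with x hx
  rw [← hx, ← Finset.sum_mul, neg_mul]

/-! ### Radial potentials in one variable -/

/-- The mass `∫₀ˢ t^(n-1) f(t) dt` of the radial density `f` inside the ball of radius `s`, up to
the area of the unit sphere. -/
noncomputable def radialMass (n : ℕ) (f : ℝ → ℝ) (s : ℝ) : ℝ :=
  ∫ t in (0 : ℝ)..s, t ^ ((n : ℝ) - 1) * f t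

/-- The profile of the radial solution of `-Δu = f`, `u = 0` on the sphere of radius `R`. -/
noncomputable def radialPotential (n : ℕ) (R : ℝ) (f : ℝ → ℝ) (r : ℝ) : ℝ :=
  ∫ s in r..R, s ^ (1 - (n : ℝ)) * radialMass n f s

theorem intervalIntegrable_radialDensity {n : ℕ} {R κ A : ℝ} (hR : 0 < R) (hκ : 0 < κ) {f : ℝ → ℝ}
    (hf : AEStronglyMeasurable f (volume.restrict (Set.Ioo 0 R)))
    (hfle : ∀ t ∈ Set.Ioo 0 R, |f t| ≤ A * t ^ (κ - n)) :
    IntervalIntegrable (fun t => t ^ ((n : ℝ) - 1) * f t) volume 0 R := by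
  have hg : IntervalIntegrable (fun t : ℝ => A * t ^ (κ - 1)) volume 0 R :=
    (intervalIntegral.intervalIntegrable_rpow' (by linarith)).const_mul A
  rw [intervalIntegrable_iff_integrableOn_Ioo_of_le hR.le] at hg ⊢
  refine Integrable.mono' hg ?_ ?_
  · exact (Measurable.aestronglyMeasurable (by fun_prop)).mul hf
  · filter_upwards [ae_restrict_mem measurableSet_Ioo] with t ht
    rw [Real.norm_eq_abs, abs_mul, abs_of_nonneg (Real.rpow_nonneg ht.1.le _)]
    calc _ ≤ t ^ ((n : ℝ) - 1) * (A * t ^ (κ - n)) := by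
          gcongr
          · exact Real.rpow_nonneg ht.1.le _
          · exact hfle t ht
      _ = A * (t ^ ((n : ℝ) - 1) * t ^ (κ - n)) := by ring
      _ = _ := by rw [← Real.rpow_add ht.1]; ring_nf

theorem continuousOn_radialMass {n : ℕ} {R κ A : ℝ} (hR : 0 < R) (hκ : 0 < κ) {f : ℝ → ℝ}
    (hf : AEStronglyMeasurable f (volume.restrict (Set.Ioo 0 R)))
    (hfle : ∀ t ∈ Set.Ioo 0 R, |f t| ≤ A * t ^ (κ - n)) :
    ContinuousOn (radialMass n f) (Set.Icc 0 R) := by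
  have h := intervalIntegral.continuousOn_primitive_interval'
    (intervalIntegrable_radialDensity hR hκ hf hfle) Set.left_mem_uIcc
  rwa [Set.uIcc_of_le hR.le] at h

theorem abs_radialMass_le {n : ℕ} {R κ A : ℝ} (hκ : 0 < κ) {f : ℝ → ℝ}
    (hfle : ∀ t ∈ Set.Ioo 0 R, |f t| ≤ A * t ^ (κ - n)) {s : ℝ} (hs : s ∈ Set.Icc 0 R) :
    |radialMass n f s| ≤ A / κ * s ^ κ := by
  have hR' : ∀ᵐ t : ℝ, t ≠ R := by simp [ae_iff]
  have h := intervalIntegral.norm_integral_le_of_norm_le (a := 0) (b := s)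
    (f := fun t => t ^ ((n : ℝ) - 1) * f t) (g := fun t => A * t ^ (κ - 1)) (μ := volume) hs.1
    (by
      filter_upwards [hR'] with t htR ht
      have ht0 : t ∈ Set.Ioo 0 R := ⟨ht.1, lt_of_le_of_ne (ht.2.trans hs.2) htR⟩
      rw [Real.norm_eq_abs, abs_mul, abs_of_nonneg (Real.rpow_nonneg ht.1.le _)]
      calc _ ≤ t ^ ((n : ℝ) - 1) * (A * t ^ (κ - n)) := by
            gcongr
            · exact Real.rpow_nonneg ht.1.le _
            · exact hfle t ht0
        _ = A * (t ^ ((n : ℝ) - 1) * t ^ (κ - n)) := by ring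
        _ = _ := by rw [← Real.rpow_add ht.1]; ring_nf)
    ((intervalIntegral.intervalIntegrable_rpow' (by linarith)).const_mul A)
  refine h.trans_eq ?_
  rw [intervalIntegral.integral_const_mul, integral_rpow (Or.inl (by linarith)),
    sub_add_cancel, Real.zero_rpow hκ.ne']
  ring

theorem continuousOn_radialPotential_integrand {n : ℕ} {R κ A : ℝ} (hR : 0 < R) (hκ : 0 < κ)
    {f : ℝ → ℝ} (hf : AEStronglyMeasurable f (volume.restrict (Set.Ioo 0 R)))
    (hfle : ∀ t ∈ Set.Ioo 0 R, |f t| ≤ A * t ^ (κ - n)) :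
    ContinuousOn (fun s => s ^ (1 - (n : ℝ)) * radialMass n f s) (Set.Ioc 0 R) :=
  (continuousOn_id.rpow_const fun _ hx => Or.inl hx.1.ne').mul
    ((continuousOn_radialMass hR hκ hf hfle).mono Set.Ioc_subset_Icc_self)

theorem hasDerivAt_radialPotential {n : ℕ} {R κ A : ℝ} (hR : 0 < R) (hκ : 0 < κ)
    {f : ℝ → ℝ} (hf : AEStronglyMeasurable f (volume.restrict (Set.Ioo 0 R)))
    (hfle : ∀ t ∈ Set.Ioo 0 R, |f t| ≤ A * t ^ (κ - n)) {r : ℝ} (hr : r ∈ Set.Ioo 0 R) :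
    HasDerivAt (radialPotential n R f) (-(r ^ (1 - (n : ℝ)) * radialMass n f r)) r := by
  have hc := continuousOn_radialPotential_integrand hR hκ hf hfle
  have hc' := hc.mono Set.Ioo_subset_Ioc_self
  refine intervalIntegral.integral_hasDerivAt_left (ContinuousOn.intervalIntegrable ?_)
    (hc'.stronglyMeasurableAtFilter isOpen_Ioo r hr) (hc'.continuousAt (isOpen_Ioo.mem_nhds hr))
  rw [Set.uIcc_of_le hr.2.le]
  exact hc.mono fun s hs => ⟨hr.1.trans_le hs.1, hs.2⟩

theorem hasDerivAt_radialMass {n : ℕ} {R κ A : ℝ} (hR : 0 < R) (hκ : 0 < κ)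
    {f : ℝ → ℝ} (hf : ContinuousOn f (Set.Ioo 0 R))
    (hfle : ∀ t ∈ Set.Ioo 0 R, |f t| ≤ A * t ^ (κ - n)) {r : ℝ} (hr : r ∈ Set.Ioo 0 R) :
    HasDerivAt (radialMass n f) (r ^ ((n : ℝ) - 1) * f r) r := by
  have hI := intervalIntegrable_radialDensity hR hκ (hf.aestronglyMeasurable measurableSet_Ioo) hfle
  have hc : ContinuousOn (fun t => t ^ ((n : ℝ) - 1) * f t) (Set.Ioo 0 R) :=
    (continuousOn_id.rpow_const fun x hx => Or.inl hx.1.ne').mul hf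
  refine intervalIntegral.integral_hasDerivAt_right (hI.mono_set ?_)
    (hc.stronglyMeasurableAtFilter isOpen_Ioo r hr) (hc.continuousAt (isOpen_Ioo.mem_nhds hr))
  rw [Set.uIcc_of_le hr.1.le, Set.uIcc_of_le hR.le]
  exact Set.Icc_subset_Icc_right hr.2.le

theorem contDiffOn_radialPotential {n : ℕ} {R κ A : ℝ} (hR : 0 < R) (hκ : 0 < κ)
    {f : ℝ → ℝ} (hf : ContinuousOn f (Set.Ioo 0 R))
    (hfle : ∀ t ∈ Set.Ioo 0 R, |f t| ≤ A * t ^ (κ - n)) :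
    ContDiffOn ℝ 2 (radialPotential n R f) (Set.Ioo 0 R) := by
  have hm := hf.aestronglyMeasurable (μ := volume) measurableSet_Ioo
  have hrpow : ∀ a : ℝ, ContDiffOn ℝ 1 (fun s : ℝ => s ^ a) (Set.Ioo 0 R) := fun a =>
    contDiffOn_id.rpow_const_of_ne fun x hx => hx.1.ne'
  have hmass : ContDiffOn ℝ 1 (radialMass n f) (Set.Ioo 0 R) := by
    rw [show (1 : WithTop ℕ∞) = 0 + 1 by simp, contDiffOn_succ_iff_deriv_of_isOpen isOpen_Ioo]
    refine ⟨fun r hr => (hasDerivAt_radialMass hR hκ hf hfle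
      hr).differentiableAt.differentiableWithinAt, by simp, contDiffOn_zero.2 ?_⟩
    refine ContinuousOn.congr ((continuousOn_id.rpow_const fun x hx => Or.inl hx.1.ne').mul hf)
      fun r hr => (hasDerivAt_radialMass hR hκ hf hfle hr).deriv
  rw [show (2 : WithTop ℕ∞) = 1 + 1 by norm_num, contDiffOn_succ_iff_deriv_of_isOpen isOpen_Ioo]
  refine ⟨fun r hr => (hasDerivAt_radialPotential hR hκ hm hfle
    hr).differentiableAt.differentiableWithinAt, by simp, ?_⟩
  exact (((hrpow _).mul hmass).neg).congr fun r hr =>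
    (hasDerivAt_radialPotential hR hκ hm hfle hr).deriv

/-- The potential grows at most like `r^(2-n)` at the origin and vanishes linearly at the sphere. -/
theorem exists_abs_radialPotential_le {n : ℕ} (hn : 3 ≤ n) {R κ A : ℝ} (hR : 0 < R) (hκ : 0 < κ)
    (hA : 0 ≤ A) {f : ℝ → ℝ}
    (hfle : ∀ t ∈ Set.Ioo 0 R, |f t| ≤ A * t ^ (κ - n)) :
    ∃ C, 0 ≤ C ∧ ∀ r ∈ Set.Ioo 0 R,
      |radialPotential n R f r| ≤ C * r ^ (2 - n : ℝ) * (R ^ 2 - r ^ 2) := by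
  have hn' : (3 : ℝ) ≤ n := by exact_mod_cast hn
  set M := A / κ * R ^ κ with hM
  have hM0 : 0 ≤ M := by positivity
  refine ⟨M * (2 / R ^ 2), by positivity, fun r hr => ?_⟩
  have hr0 : 0 < r := hr.1
  have hint : ∀ s ∈ Set.Ioc r R, ‖s ^ (1 - (n : ℝ)) * radialMass n f s‖ ≤ s ^ (1 - (n : ℝ)) * M := by
    intro s hs
    have hs0 : 0 < s := hr0.trans hs.1
    rw [Real.norm_eq_abs, abs_mul, abs_of_nonneg (Real.rpow_nonneg hs0.le _)]
    gcongr
    refine (abs_radialMass_le hκ hfle ⟨hs0.le, hs.2⟩).trans ?_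
    rw [hM]
    gcongr
    exact hs.2
  have hpos : 0 < r ^ (2 - n : ℝ) := Real.rpow_pos_of_pos hr0 _
  have hRr : 0 < R - r := sub_pos.2 hr.2
  -- Near the sphere the length of the interval is used, near the origin the decay of `s^(1-n)`.
  have hmain : |radialPotential n R f r| ≤ M * (2 / R) * r ^ (2 - n : ℝ) * (R - r) := by
    rcases le_total (R / 2) r with h | h
    · have hb : ∀ s ∈ Set.uIoc r R,
          ‖s ^ (1 - (n : ℝ)) * radialMass n f s‖ ≤ r ^ (1 - (n : ℝ)) * M := by
        intro s hs
        rw [Set.uIoc_of_le hr.2.le] at hs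
        exact (hint s hs).trans (mul_le_mul_of_nonneg_right
          (Real.rpow_le_rpow_of_nonpos hr0 hs.1.le (by linarith)) hM0)
      have h1 : |radialPotential n R f r| ≤ r ^ (1 - (n : ℝ)) * M * |R - r| :=
        intervalIntegral.norm_integral_le_of_norm_le_const hb
      rw [abs_of_pos hRr] at h1
      refine h1.trans ?_
      have h2 : r ^ (1 - (n : ℝ)) ≤ 2 / R * r ^ (2 - n : ℝ) := by
        rw [show (1 : ℝ) - n = (2 - n) - 1 by ring, Real.rpow_sub_one hr0.ne', div_eq_inv_mul]
        gcongr
        rw [inv_le_comm₀ hr0 (by positivity), inv_div]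
        exact h
      calc _ ≤ (2 / R * r ^ (2 - n : ℝ)) * M * (R - r) := by gcongr
        _ = _ := by ring
    · have h0 : (0 : ℝ) ∉ Set.uIcc r R := by
        rw [Set.uIcc_of_le hr.2.le]
        exact fun h => absurd h.1 (not_le.2 hr0)
      have h1 := intervalIntegral.norm_integral_le_of_norm_le (a := r) (b := R)
        (f := fun s => s ^ (1 - (n : ℝ)) * radialMass n f s) (g := fun s => s ^ (1 - (n : ℝ)) * M)
        (μ := volume) hr.2.le (ae_of_all _ hint)
        ((intervalIntegral.intervalIntegrable_rpow (Or.inr h0)).mul_const M)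
      rw [intervalIntegral.integral_mul_const, integral_rpow (Or.inr ⟨by linarith, h0⟩),
        show 1 - (n : ℝ) + 1 = 2 - n by ring] at h1
      refine (show |radialPotential n R f r| ≤ _ from h1).trans ?_
      have h2 : (R ^ (2 - n : ℝ) - r ^ (2 - n : ℝ)) / (2 - n) ≤ r ^ (2 - n : ℝ) := by
        rw [div_le_iff_of_neg (by linarith)]
        have := Real.rpow_pos_of_pos hR (2 - n : ℝ)
        nlinarith
      have h3 : 1 ≤ 2 / R * (R - r) := by
        rw [div_mul_eq_mul_div, le_div_iff₀ hR]
        linarith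
      calc _ ≤ r ^ (2 - n : ℝ) * M * 1 := by rw [mul_one]; gcongr
        _ ≤ r ^ (2 - n : ℝ) * M * (2 / R * (R - r)) := by gcongr
        _ = _ := by ring
  refine hmain.trans ?_
  have h4 : R * (R - r) ≤ R ^ 2 - r ^ 2 := by nlinarith
  calc _ = M * (2 / R ^ 2) * r ^ (2 - n : ℝ) * (R * (R - r)) := by field_simp
    _ ≤ _ := by gcongr

theorem partialDeriv_comp_norm {n : ℕ} {h : ℝ → ℝ} {h' : ℝ} {x : EuclideanSpace ℝ (Fin n)}
    (hx : x ≠ 0) (hh : HasDerivAt h h' ‖x‖) (i : Fin n) :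
    DifferentiableAt ℝ (fun y : EuclideanSpace ℝ (Fin n) => h ‖y‖) x ∧
      partialDeriv i (fun y => h ‖y‖) x = h' * (x i / ‖x‖) := by
  have hx0 : ‖x‖ ≠ 0 := norm_ne_zero_iff.2 hx
  have hn : HasFDerivAt (fun y : EuclideanSpace ℝ (Fin n) => ‖y‖) (fderiv ℝ (fun y => ‖y‖) x) x :=
    ((contDiffAt_norm ℝ hx (n := 1)).differentiableAt (by simp)).hasFDerivAt
  have hsq : fderiv ℝ (fun y : EuclideanSpace ℝ (Fin n) => ‖y‖) x (EuclideanSpace.single i 1)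
      = x i / ‖x‖ := by
    have e1 := (hn.pow 2).fderiv
    rw [(hasStrictFDerivAt_norm_sq x).hasFDerivAt.fderiv] at e1
    have e2 := congrArg (fun T => T (EuclideanSpace.single i 1)) e1
    simp [EuclideanSpace.inner_single_right] at e2
    rw [eq_div_iff hx0]
    linarith
  have hc := hh.comp_hasFDerivAt x hn
  refine ⟨hc.differentiableAt, ?_⟩
  have := hc.fderiv
  rw [partialDeriv, show (fun y : EuclideanSpace ℝ (Fin n) => h ‖y‖) = h ∘ fun y => ‖y‖ from rfl,
    this, ← hsq]
  simp

/-! ### Radial potentials on the ball -/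

/-- The radial potential of a density `f` with `|f(t)| ≤ A t^(κ-n)` solves `-Δu = f` in the sense
of distributions, with zero boundary values. The value of the profile at `0` is irrelevant. -/
theorem negLaplacianEq_radialPotential {n : ℕ} (hn : 3 ≤ n) {R κ A : ℝ} (hR : 0 < R) (hκ : 0 < κ)
    (hA : 0 ≤ A) {f W : ℝ → ℝ} (hf : ContinuousOn f (Set.Ioo 0 R))
    (hfle : ∀ t ∈ Set.Ioo 0 R, |f t| ≤ A * t ^ (κ - n))
    (hW : ∀ r ∈ Set.Ioo 0 R, W r = radialPotential n R f r) :
    MemSobolevZero (originBall n R) 1 (fun x => W ‖x‖) ∧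
      MemSobolev (originBall n R) 1 2 (fun x => W ‖x‖) ∧
      NegLaplacianEq (originBall n R) (fun x => W ‖x‖) (fun x => f ‖x‖) := by
  have hopen := isOpen_puncturedBall n R
  have hm := hf.aestronglyMeasurable (μ := volume) measurableSet_Ioo
  have hIoo : ∀ x ∈ puncturedBall n R, ‖x‖ ∈ Set.Ioo 0 R := fun x hx => mem_puncturedBall.1 hx
  have hne : ∀ x ∈ puncturedBall n R, x ≠ 0 := fun x hx => norm_pos_iff.1 (hIoo x hx).1
  obtain ⟨C, hC, hCle⟩ := exists_abs_radialPotential_le hn hR hκ hA hfle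
  have hW' : ∀ r ∈ Set.Ioo 0 R, HasDerivAt W (-(r ^ (1 - (n : ℝ)) * radialMass n f r)) r := by
    intro r hr
    refine (hasDerivAt_radialPotential hR hκ hm hfle hr).congr_of_eventuallyEq ?_
    filter_upwards [isOpen_Ioo.mem_nhds hr] with s hs using hW s hs
  -- The gradient of `W ‖x‖` is the vector field `g ‖x‖ • x`.
  set g : ℝ → ℝ := fun r => -(r ^ (-(n : ℝ)) * radialMass n f r) with hg
  have hD : ∀ i, ∀ x ∈ puncturedBall n R,
      partialDeriv i (fun x => W ‖x‖) x = g ‖x‖ * x i := by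
    intro i x hx
    have h0 := (hIoo x hx).1
    rw [(partialDeriv_comp_norm (hne x hx) (hW' _ (hIoo x hx)) i).2, hg,
      show (1 : ℝ) - n = -n + 1 by ring, Real.rpow_add_one h0.ne']
    field_simp
  have hg' : ∀ r ∈ Set.Ioo 0 R,
      HasDerivAt g ((n * r ^ (-(n : ℝ)) * radialMass n f r - f r) / r) r := by
    intro r hr
    have h1 := Real.hasDerivAt_rpow_const (x := r) (p := -(n : ℝ)) (Or.inl hr.1.ne')
    refine (h1.mul (hasDerivAt_radialMass hR hκ hf hfle hr)).neg.congr_deriv ?_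
    have h2 : r ^ (-(n : ℝ)) * r ^ ((n : ℝ) - 1) = r⁻¹ := by
      rw [← Real.rpow_add hr.1, ← Real.rpow_neg_one]; ring_nf
    rw [Real.rpow_sub_one hr.1.ne', ← mul_assoc, h2]
    field_simp
    ring
  have hDD : ∀ i j, ∀ x ∈ puncturedBall n R,
      partialDeriv j (partialDeriv i (fun x => W ‖x‖)) x = g ‖x‖ * (if i = j then 1 else 0)
        + x i * ((n * ‖x‖ ^ (-(n : ℝ)) * radialMass n f ‖x‖ - f ‖x‖) / ‖x‖ * (x j / ‖x‖)) := by
    intro i j x hx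
    have hev : partialDeriv i (fun x => W ‖x‖) =ᶠ[𝓝 x] fun y => g ‖y‖ * y i := by
      filter_upwards [hopen.mem_nhds hx] with y hy using hD i y hy
    have hp := partialDeriv_comp_norm (hne x hx) (hg' _ (hIoo x hx)) j
    have hproj : HasFDerivAt (fun y : EuclideanSpace ℝ (Fin n) => y i)
        (EuclideanSpace.proj i : EuclideanSpace ℝ (Fin n) →L[ℝ] ℝ) x :=
      (EuclideanSpace.proj i : EuclideanSpace ℝ (Fin n) →L[ℝ] ℝ).hasFDerivAt
    have e1 : partialDeriv j (fun y : EuclideanSpace ℝ (Fin n) => y i) x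
        = if i = j then 1 else 0 := by
      rw [partialDeriv, hproj.fderiv]
      simp
    rw [partialDeriv, hev.fderiv_eq]
    exact (partialDeriv_mul j hp.1 hproj.differentiableAt).trans (by rw [e1, hp.2])
  have hgle : ∀ r ∈ Set.Ioo 0 R, |r ^ (-(n : ℝ)) * radialMass n f r| ≤ A / κ * r ^ (κ - n) := by
    intro r hr
    rw [abs_mul, abs_of_nonneg (Real.rpow_nonneg hr.1.le _)]
    calc _ ≤ r ^ (-(n : ℝ)) * (A / κ * r ^ κ) := by
          gcongr
          · exact Real.rpow_nonneg hr.1.le _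
          · exact abs_radialMass_le hκ hfle ⟨hr.1.le, hr.2.le⟩
      _ = A / κ * (r ^ κ * r ^ (-(n : ℝ))) := by ring
      _ = _ := by rw [← Real.rpow_add hr.1]; ring_nf
  have hcoord : ∀ (x : EuclideanSpace ℝ (Fin n)) i, |x i| ≤ ‖x‖ := fun x i => by
    simpa using PiLp.norm_apply_le x i
  set C' := C + (A / κ + (n * (A / κ) + A)) with hC'
  have hC'0 : 0 ≤ C' := by positivity
  have hle1 : C ≤ C' := by rw [hC']; exact le_add_of_nonneg_right (by positivity)
  have hle2 : A / κ + (n * (A / κ) + A) ≤ C' := by rw [hC']; exact le_add_of_nonneg_left hC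
  refine memSobolev_two_and_negLaplacianEq (by omega) hR hC'0 hκ ?_ ?_ ?_ ?_ ?_
  · have h1 : ContDiffOn ℝ 2 W (Set.Ioo 0 R) :=
      (contDiffOn_radialPotential hR hκ hf hfle).congr hW
    exact h1.comp (contDiffOn_id.norm ℝ hne) hIoo
  · intro x hx
    have hr := hIoo x hx
    rw [hW _ hr]
    refine (hCle _ hr).trans ?_
    have h3 : 0 ≤ R ^ 2 - ‖x‖ ^ 2 := by nlinarith [hr.1, hr.2]
    gcongr
  · intro i x hx
    have hr := hIoo x hx
    rw [hD i x hx, hg, abs_mul, abs_neg]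
    calc _ ≤ A / κ * ‖x‖ ^ (κ - n) * ‖x‖ := by
          gcongr
          · exact hgle _ hr
          · exact hcoord x i
      _ = A / κ * ‖x‖ ^ (1 - (n - κ)) := by
          rw [mul_assoc, ← Real.rpow_add_one hr.1.ne']; ring_nf
      _ ≤ _ := by
          gcongr
          exact le_trans (le_add_of_nonneg_right (by positivity)) hle2
  · intro i j x hx
    have hr := hIoo x hx
    have hr0 := hr.1
    rw [hDD i j x hx, show -((n : ℝ) - κ) = κ - n by ring]
    have b1 : |g ‖x‖ * (if i = j then 1 else 0)| ≤ A / κ * ‖x‖ ^ (κ - n) := by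
      rw [abs_mul, hg, abs_neg]
      refine le_trans (mul_le_of_le_one_right (abs_nonneg _) ?_) (hgle _ hr)
      split_ifs <;> simp
    have b2 : |n * ‖x‖ ^ (-(n : ℝ)) * radialMass n f ‖x‖ - f ‖x‖|
        ≤ (n * (A / κ) + A) * ‖x‖ ^ (κ - n) := by
      refine (abs_sub _ _).trans ?_
      rw [add_mul, mul_assoc, abs_mul, Nat.abs_cast, mul_assoc]
      gcongr
      · exact hgle _ hr
      · exact hfle _ hr
    have b3 : |x i * ((n * ‖x‖ ^ (-(n : ℝ)) * radialMass n f ‖x‖ - f ‖x‖) / ‖x‖ * (x j / ‖x‖))|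
        ≤ (n * (A / κ) + A) * ‖x‖ ^ (κ - n) := by
      rw [abs_mul, abs_mul, abs_div, abs_div, abs_norm]
      calc _ ≤ ‖x‖ * ((n * (A / κ) + A) * ‖x‖ ^ (κ - n) / ‖x‖ * (‖x‖ / ‖x‖)) := by
            gcongr
            · exact hcoord x i
            · exact hcoord x j
        _ = _ := by field_simp
    refine (abs_add_le _ _).trans ((add_le_add b1 b3).trans ?_)
    rw [← add_mul]
    gcongr
  · intro x hx
    have hr0 := (hIoo x hx).1
    simp_rw [hDD _ _ x hx]
    have hsq : ∑ i, x i * x i = ‖x‖ ^ 2 := by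
      rw [EuclideanSpace.norm_sq_eq]
      exact Finset.sum_congr rfl fun i _ => by rw [Real.norm_eq_abs, sq_abs, sq]
    have e : ∀ i, x i * ((n * ‖x‖ ^ (-(n : ℝ)) * radialMass n f ‖x‖ - f ‖x‖) / ‖x‖ * (x i / ‖x‖))
        = (n * ‖x‖ ^ (-(n : ℝ)) * radialMass n f ‖x‖ - f ‖x‖) / ‖x‖ ^ 2 * (x i * x i) := by
      intro i
      field_simp
    simp_rw [e]
    rw [Finset.sum_add_distrib, ← Finset.mul_sum, ← Finset.mul_sum, hsq, hg]
    simp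
    field_simp
    ring

/-! ### The radial Green kernel and the radial measures -/

/-- The integrand, at `(r, t, s)`, of the radial Green kernel. -/
noncomputable def greenIntegrand (n : ℕ) : ℝ × ℝ × ℝ → ℝ≥0∞ :=
  {z : ℝ × ℝ × ℝ | (0 < z.1 ∧ 0 < z.2.1) ∧ z.1 < z.2.2 ∧ z.2.1 < z.2.2}.indicator
    fun z => ENNReal.ofReal (z.2.2 ^ (1 - (n : ℝ)))

/-- The radial Green kernel of the Dirichlet Laplacian on the ball of radius `R`, that is
`∫ s^(1-n) ds` over `max r t < s < R`, extended by zero to nonpositive `r` or `t`. -/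
noncomputable def greenKernel (n : ℕ) (R r t : ℝ) : ℝ≥0∞ :=
  ∫⁻ s in Set.Ioo 0 R, greenIntegrand n (r, t, s)

theorem measurable_greenIntegrand (n : ℕ) : Measurable (greenIntegrand n) := by
  have h1 : Measurable fun z : ℝ × ℝ × ℝ => z.1 := by fun_prop
  have h2 : Measurable fun z : ℝ × ℝ × ℝ => z.2.1 := by fun_prop
  have h3 : Measurable fun z : ℝ × ℝ × ℝ => z.2.2 := by fun_prop
  exact Measurable.indicator (by fun_prop)
    (((measurableSet_lt measurable_const h1).inter (measurableSet_lt measurable_const h2)).inter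
      ((measurableSet_lt h1 h3).inter (measurableSet_lt h2 h3)))

theorem measurable_greenKernel (n : ℕ) (R : ℝ) :
    Measurable (Function.uncurry (greenKernel n R)) :=
  Measurable.lintegral_prod_right' (ν := volume.restrict (Set.Ioo 0 R))
    (f := fun z : (ℝ × ℝ) × ℝ => greenIntegrand n (z.1.1, z.1.2, z.2))
    ((measurable_greenIntegrand n).comp (by fun_prop))

theorem greenKernel_comm (n : ℕ) (R r t : ℝ) : greenKernel n R r t = greenKernel n R t r := by
  refine lintegral_congr fun s => ?_
  simp only [greenIntegrand, Set.indicator, Set.mem_ofPred_eq]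
  congr 1
  exact propext ⟨fun h => ⟨h.1.symm, h.2.symm⟩, fun h => ⟨h.1.symm, h.2.symm⟩⟩

/-- The singularity of the Green kernel is split between its two variables. -/
theorem greenKernel_le {n : ℕ} (hn : 3 ≤ n) (R : ℝ) {σ τ : ℝ} (hσ : 0 ≤ σ) (hτ : 0 ≤ τ)
    (hστ : σ + τ = n - 2) (t r : ℝ) :
    greenKernel n R t r ≤ ENNReal.ofReal (t ^ (-τ)) * ENNReal.ofReal (r ^ (-σ)) := by
  have hn' : (3 : ℝ) ≤ n := by exact_mod_cast hn
  by_cases h0 : 0 < t ∧ 0 < r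
  · set ρ := max t r with hρ
    have hρ0 : 0 < ρ := lt_max_of_lt_left h0.1
    have h1 : greenKernel n R t r ≤ ∫⁻ s in Set.Ioi ρ, ENNReal.ofReal (s ^ (1 - (n : ℝ))) := by
      rw [← lintegral_indicator measurableSet_Ioi]
      refine (setLIntegral_le_lintegral _ _).trans (lintegral_mono fun s => ?_)
      simp only [greenIntegrand, Set.indicator, Set.mem_ofPred_eq, Set.mem_Ioi]
      split_ifs with h2 h3
      · exact le_rfl
      · exact absurd (max_lt h2.2.1 h2.2.2) h3
      · exact zero_le
      · exact le_rfl
    have h2 : ∫⁻ s in Set.Ioi ρ, ENNReal.ofReal (s ^ (1 - (n : ℝ)))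
        = ENNReal.ofReal (-ρ ^ (2 - n : ℝ) / (2 - n)) := by
      rw [← ofReal_integral_eq_lintegral_ofReal (integrableOn_Ioi_rpow_of_lt (by linarith) hρ0),
        integral_Ioi_rpow_of_lt (by linarith) hρ0, show 1 - (n : ℝ) + 1 = 2 - n by ring]
      filter_upwards [ae_restrict_mem measurableSet_Ioi] with s hs
      exact Real.rpow_nonneg (hρ0.le.trans (le_of_lt hs)) _
    rw [h2] at h1
    refine h1.trans ?_
    rw [← ENNReal.ofReal_mul (Real.rpow_nonneg h0.1.le _)]
    refine ENNReal.ofReal_le_ofReal ?_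
    have hpos := Real.rpow_pos_of_pos hρ0 (2 - n : ℝ)
    calc -ρ ^ (2 - n : ℝ) / (2 - n) ≤ ρ ^ (2 - n : ℝ) := by
          rw [div_le_iff_of_neg (by linarith)]
          nlinarith
      _ = ρ ^ (-τ) * ρ ^ (-σ) := by
          rw [← Real.rpow_add hρ0]
          congr 1
          linarith
      _ ≤ _ := by
          have h3 := Real.rpow_le_rpow_of_nonpos h0.1 (le_max_left t r) (neg_nonpos.2 hτ)
          have h4 := Real.rpow_le_rpow_of_nonpos h0.2 (le_max_right t r) (neg_nonpos.2 hσ)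
          have h5 := Real.rpow_nonneg hρ0.le (-σ)
          have h6 := Real.rpow_nonneg h0.1.le (-τ)
          exact mul_le_mul h3 h4 h5 h6
  · have : greenKernel n R t r = 0 := by
      simp [greenKernel, greenIntegrand, Set.indicator, h0]
    rw [this]
    exact zero_le

theorem greenKernel_ne_zero {n : ℕ} {R t r : ℝ} (ht : t ∈ Set.Ioo 0 R) (hr : r ∈ Set.Ioo 0 R) :
    greenKernel n R t r ≠ 0 := by
  have hρ : max t r < R := max_lt ht.2 hr.2
  have hρ0 : 0 < max t r := lt_max_of_lt_left ht.1
  have hm : Measurable fun s : ℝ =>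
      greenIntegrand n (t, r, s) :=
    (measurable_greenIntegrand n).comp (by fun_prop)
  refine ((lintegral_pos_iff_support hm).2 ?_).ne'
  refine lt_of_lt_of_le ?_ (measure_mono (s := Set.Ioo (max t r) R) fun s hs => ?_)
  · rw [Measure.restrict_apply measurableSet_Ioo,
      Set.inter_eq_left.2 (Set.Ioo_subset_Ioo_left hρ0.le)]
    simpa using hρ
  · have h1 : (0 < t ∧ 0 < r) ∧ t < s ∧ r < s :=
      ⟨⟨ht.1, hr.1⟩, (le_max_left t r).trans_lt hs.1, (le_max_right t r).trans_lt hs.1⟩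
    simpa [greenIntegrand, Set.indicator, h1] using Real.rpow_pos_of_pos (hρ0.trans hs.1) _

/-- Integrating against the Green kernel produces the radial potential. -/
theorem lintegral_greenKernel {n : ℕ} {R κ A : ℝ} (hR : 0 < R) (hκ : 0 < κ) {f : ℝ → ℝ}
    (hf : Measurable f) (hf0 : ∀ t ∈ Set.Ioo 0 R, 0 ≤ f t)
    (hfle : ∀ t ∈ Set.Ioo 0 R, |f t| ≤ A * t ^ (κ - n)) {r : ℝ} (hr : r ∈ Set.Ioo 0 R) :
    ∫⁻ t in Set.Ioo 0 R, greenKernel n R t r * ENNReal.ofReal (t ^ ((n : ℝ) - 1) * f t)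
      = ENNReal.ofReal (radialPotential n R f r) := by
  have hd0 : ∀ t ∈ Set.Ioo 0 R, 0 ≤ t ^ ((n : ℝ) - 1) * f t := fun t ht =>
    mul_nonneg (Real.rpow_nonneg ht.1.le _) (hf0 t ht)
  have hdI := intervalIntegrable_radialDensity hR hκ hf.aestronglyMeasurable hfle
  have hmass : ∀ s ∈ Set.Ioo 0 R, 0 ≤ radialMass n f s ∧
      ENNReal.ofReal (radialMass n f s)
        = ∫⁻ t in Set.Ioo 0 s, ENNReal.ofReal (t ^ ((n : ℝ) - 1) * f t) := by
    intro s hs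
    have hsub : Set.Ioo 0 s ⊆ Set.Ioo 0 R := Set.Ioo_subset_Ioo_right hs.2.le
    have hI : IntegrableOn (fun t => t ^ ((n : ℝ) - 1) * f t) (Set.Ioo 0 s) :=
      ((intervalIntegrable_iff_integrableOn_Ioo_of_le hR.le).1 hdI).mono_set hsub
    have h0 : 0 ≤ᵐ[volume.restrict (Set.Ioo 0 s)] fun t => t ^ ((n : ℝ) - 1) * f t := by
      filter_upwards [ae_restrict_mem measurableSet_Ioo] with t ht using hd0 t (hsub ht)
    have e : radialMass n f s = ∫ t in Set.Ioo 0 s, t ^ ((n : ℝ) - 1) * f t := by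
      rw [radialMass, intervalIntegral.integral_of_le hs.1.le, integral_Ioc_eq_integral_Ioo]
    exact ⟨e ▸ integral_nonneg_of_ae h0, by rw [e, ofReal_integral_eq_lintegral_ofReal hI h0]⟩
  have hdm : Measurable fun t => ENNReal.ofReal (t ^ ((n : ℝ) - 1) * f t) := by fun_prop
  calc _ = ∫⁻ t in Set.Ioo 0 R, ∫⁻ s in Set.Ioo 0 R,
        greenIntegrand n (t, r, s)
          * ENNReal.ofReal (t ^ ((n : ℝ) - 1) * f t) := by
        refine lintegral_congr fun t => (lintegral_mul_const _ ?_).symm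
        exact (measurable_greenIntegrand n).comp (by fun_prop)
    _ = ∫⁻ s in Set.Ioo 0 R, ∫⁻ t in Set.Ioo 0 R,
        greenIntegrand n (t, r, s)
          * ENNReal.ofReal (t ^ ((n : ℝ) - 1) * f t) := by
        refine lintegral_lintegral_swap (Measurable.aemeasurable ?_)
        exact ((measurable_greenIntegrand n).comp
          (f := fun z : ℝ × ℝ => (z.1, r, z.2)) (by fun_prop)).mul (hdm.comp measurable_fst)
    _ = ∫⁻ s in Set.Ioo 0 R, (Set.Ioo r R).indicator
          (fun s => ENNReal.ofReal (s ^ (1 - (n : ℝ)) * radialMass n f s)) s := by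
        refine setLIntegral_congr_fun measurableSet_Ioo fun s hs => ?_
        by_cases hrs : r < s
        · have hsr : s ∈ Set.Ioo r R := ⟨hrs, hs.2⟩
          simp only [Set.indicator_of_mem hsr]
          rw [ENNReal.ofReal_mul (Real.rpow_nonneg hs.1.le _), (hmass s hs).2,
            ← lintegral_const_mul _ hdm, ← lintegral_indicator measurableSet_Ioo,
            ← lintegral_indicator measurableSet_Ioo]
          refine lintegral_congr fun t => ?_
          simp only [greenIntegrand, Set.indicator, Set.mem_ofPred_eq, Set.mem_Ioo, hrs, hr.1, and_true]
          by_cases ht : 0 < t ∧ t < s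
          · simp [ht, ht.2.trans hs.2]
          · by_cases ht0 : 0 < t
            · have hts : ¬ t < s := fun h => ht ⟨ht0, h⟩
              simp [hts]
            · simp [ht0]
        · have hsr : s ∉ Set.Ioo r R := fun h => hrs h.1
          simp only [Set.indicator_of_notMem hsr]
          refine (lintegral_congr fun t => ?_).trans lintegral_zero
          simp [greenIntegrand, Set.indicator, hrs]
    _ = ∫⁻ s in Set.Ioo r R, ENNReal.ofReal (s ^ (1 - (n : ℝ)) * radialMass n f s) := by
        rw [lintegral_indicator measurableSet_Ioo,
          Measure.restrict_restrict measurableSet_Ioo,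
          Set.inter_eq_left.2 (Set.Ioo_subset_Ioo_left hr.1.le)]
    _ = _ := by
        have hc := continuousOn_radialPotential_integrand hR hκ hf.aestronglyMeasurable hfle
        have hI : IntervalIntegrable (fun s => s ^ (1 - (n : ℝ)) * radialMass n f s) volume r R := by
          refine ContinuousOn.intervalIntegrable ?_
          rw [Set.uIcc_of_le hr.2.le]
          exact hc.mono fun s hs => ⟨hr.1.trans_le hs.1, hs.2⟩
        rw [intervalIntegrable_iff_integrableOn_Ioo_of_le hr.2.le] at hI
        rw [radialPotential, intervalIntegral.integral_of_le hr.2.le, integral_Ioc_eq_integral_Ioo,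
          ofReal_integral_eq_lintegral_ofReal hI]
        filter_upwards [ae_restrict_mem measurableSet_Ioo] with s hs
        have hs' : s ∈ Set.Ioo 0 R := ⟨hr.1.trans hs.1, hs.2⟩
        exact mul_nonneg (Real.rpow_nonneg hs'.1.le _) (hmass s hs').1

/-- The image under the radius, up to a constant, of the measure `|x|^a dx` on the ball of
radius `R` in `ℝⁿ`. -/
noncomputable def radialMeasure (n : ℕ) (a R : ℝ) : Measure ℝ :=
  (volume.restrict (Set.Ioo 0 R)).withDensity fun t => ENNReal.ofReal (t ^ (a + n - 1))

theorem lintegral_radialMeasure (n : ℕ) (a R : ℝ) {F : ℝ → ℝ≥0∞} (hF : Measurable F) :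
    ∫⁻ t, F t ∂radialMeasure n a R
      = ∫⁻ t in Set.Ioo 0 R, ENNReal.ofReal (t ^ (a + n - 1)) * F t :=
  lintegral_withDensity_eq_lintegral_mul _ (by fun_prop) hF

theorem lintegral_rpow_ne_top {R γ : ℝ} (hR : 0 < R) (hγ : -1 < γ) :
    ∫⁻ t in Set.Ioo 0 R, ENNReal.ofReal (t ^ γ) ≠ ∞ := by
  have h : IntegrableOn (fun t : ℝ => t ^ γ) (Set.Ioo 0 R) :=
    (intervalIntegral.integrableOn_Ioo_rpow_iff hR).2 hγ
  exact h.lintegral_lt_top.ne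

theorem isFiniteMeasure_radialMeasure {n : ℕ} {a R : ℝ} (hR : 0 < R) (ha : -(n : ℝ) < a) :
    IsFiniteMeasure (radialMeasure n a R) :=
  isFiniteMeasure_withDensity (lintegral_rpow_ne_top hR (by linarith))

theorem ae_mem_Ioo_radialMeasure (n : ℕ) (a R : ℝ) :
    ∀ᵐ t ∂radialMeasure n a R, t ∈ Set.Ioo 0 R :=
  (withDensity_absolutelyContinuous _ _).ae_le (ae_restrict_mem measurableSet_Ioo)

theorem radialMeasure_ne_zero (n : ℕ) (a : ℝ) {R : ℝ} (hR : 0 < R) : radialMeasure n a R ≠ 0 := by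
  intro h
  have h1 := (lintegral_radialMeasure n a R (F := fun _ => 1) measurable_const).symm
  rw [h, lintegral_zero_measure] at h1
  have hm : Measurable fun t : ℝ => ENNReal.ofReal (t ^ (a + n - 1)) * 1 := by fun_prop
  refine ((lintegral_pos_iff_support hm).2 ?_).ne' h1
  refine lt_of_lt_of_le ?_ (measure_mono (s := Set.Ioo 0 R) fun t ht => ?_)
  · simpa using hR
  · simpa using Real.rpow_pos_of_pos ht.1 _

theorem lintegral_rpow_radialMeasure_ne_top {n : ℕ} {a R p τ : ℝ} (hR : 0 < R) (hp : 0 < p)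
    (hτ : τ * p < a + n) :
    ∫⁻ t, ENNReal.ofReal (t ^ (-τ)) ^ p ∂radialMeasure n a R ≠ ∞ := by
  rw [lintegral_radialMeasure _ _ _ (by fun_prop)]
  refine ne_of_eq_of_ne (setLIntegral_congr_fun measurableSet_Ioo fun t ht => ?_)
    (lintegral_rpow_ne_top (γ := a + n - 1 - τ * p) hR (by linarith))
  have ht0 : 0 < t := ht.1
  rw [ENNReal.ofReal_rpow_of_nonneg (by positivity) hp.le, ← ENNReal.ofReal_mul (by positivity),
    ← Real.rpow_mul ht0.le, ← Real.rpow_add ht0]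
  ring_nf

/-! ### Passage from the integral system to the differential system -/

/-- One equation of the integral system in real-valued form. -/
theorem lintegral_greenKernel_radialMeasure {n : ℕ} {R a τ P : ℝ} (hR : 0 < R) (hP : 0 < P)
    (haτ : τ * P < a + n) {V : ℝ → ℝ≥0∞} (hV : Measurable V) {c C : ℝ≥0∞} (hc : c ≠ ∞) (hC : C ≠ ∞)
    (hVle : ∀ t, V t ≤ C * ENNReal.ofReal (t ^ (-τ))) {W : ℝ → ℝ} (hWm : Measurable W)
    (hW : ∀ t ∈ Set.Ioo 0 R, W t = (V t).toReal) :
    (∀ t ∈ Set.Ioo 0 R, |c.toReal * t ^ a * W t ^ P|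
        ≤ c.toReal * C.toReal ^ P * t ^ ((a + n - τ * P) - n)) ∧
      ∀ r ∈ Set.Ioo 0 R, c * ∫⁻ t, greenKernel n R t r * V t ^ P ∂radialMeasure n a R
        = ENNReal.ofReal (radialPotential n R (fun t => c.toReal * t ^ a * W t ^ P) r) := by
  have hVtop : ∀ t, V t ≠ ∞ := fun t =>
    ((hVle t).trans_lt (ENNReal.mul_lt_top hC.lt_top ENNReal.ofReal_lt_top)).ne
  have hW0 : ∀ t ∈ Set.Ioo 0 R, 0 ≤ W t := fun t ht => by
    rw [hW t ht]; exact ENNReal.toReal_nonneg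
  have hWle : ∀ t ∈ Set.Ioo 0 R, W t ≤ C.toReal * t ^ (-τ) := by
    intro t ht
    have h := ENNReal.toReal_mono (ENNReal.mul_ne_top hC ENNReal.ofReal_ne_top) (hVle t)
    rw [ENNReal.toReal_mul, ENNReal.toReal_ofReal (Real.rpow_nonneg ht.1.le _)] at h
    rwa [hW t ht]
  have hf0 : ∀ t ∈ Set.Ioo 0 R, 0 ≤ c.toReal * t ^ a * W t ^ P := fun t ht =>
    mul_nonneg (mul_nonneg ENNReal.toReal_nonneg (Real.rpow_nonneg ht.1.le _))
      (Real.rpow_nonneg (hW0 t ht) _)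
  have hfle : ∀ t ∈ Set.Ioo 0 R, |c.toReal * t ^ a * W t ^ P|
      ≤ c.toReal * C.toReal ^ P * t ^ ((a + n - τ * P) - n) := by
    intro t ht
    have ht0 : 0 < t := ht.1
    rw [abs_of_nonneg (hf0 t ht)]
    calc _ ≤ c.toReal * t ^ a * (C.toReal * t ^ (-τ)) ^ P := by
          gcongr
          · exact hW0 t ht
          · exact hWle t ht
      _ = c.toReal * C.toReal ^ P * (t ^ a * t ^ (-τ * P)) := by
          rw [Real.mul_rpow ENNReal.toReal_nonneg (by positivity), ← Real.rpow_mul ht0.le]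
          ring
      _ = _ := by rw [← Real.rpow_add ht0]; ring_nf
  refine ⟨hfle, fun r hr => ?_⟩
  have hfm : Measurable fun t => c.toReal * t ^ a * W t ^ P := by fun_prop
  have hkm : Measurable fun t => greenKernel n R t r :=
    (measurable_greenKernel n R).comp (measurable_id.prodMk measurable_const)
  have hm : Measurable fun t => greenKernel n R t r * V t ^ P := hkm.mul (hV.pow_const _)
  rw [← lintegral_greenKernel hR (by linarith) hfm hf0 hfle hr, ← lintegral_const_mul _ hm,
    lintegral_radialMeasure _ _ _ (hm.const_mul c)]
  refine setLIntegral_congr_fun measurableSet_Ioo fun t ht => ?_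
  have ht0 : 0 < t := ht.1
  have e1 : c = ENNReal.ofReal c.toReal := (ENNReal.ofReal_toReal hc).symm
  have e2 : V t ^ P = ENNReal.ofReal (W t ^ P) := by
    rw [← ENNReal.ofReal_rpow_of_nonneg (hW0 t ht) hP.le, hW t ht, ENNReal.ofReal_toReal (hVtop t)]
  have e3 : t ^ ((n : ℝ) - 1) * (c.toReal * t ^ a * W t ^ P)
      = t ^ (a + n - 1) * (c.toReal * W t ^ P) := by
    rw [show a + (n : ℝ) - 1 = (n - 1) + a by ring, Real.rpow_add ht0]
    ring
  simp only [e3, e2]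
  rw [ENNReal.ofReal_mul (by positivity), ENNReal.ofReal_mul ENNReal.toReal_nonneg, ← e1]
  ring

/-- Continuity of the profile follows from the integral equation alone, so that the density of the
other equation is continuous as well. -/
theorem continuousOn_of_eq_radialPotential {n : ℕ} {R κ A : ℝ} (hR : 0 < R) (hκ : 0 < κ)
    {f W : ℝ → ℝ} (hf : Measurable f) (hfle : ∀ t ∈ Set.Ioo 0 R, |f t| ≤ A * t ^ (κ - n))
    (hW : ∀ r ∈ Set.Ioo 0 R, W r = radialPotential n R f r) : ContinuousOn W (Set.Ioo 0 R) := by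
  refine ContinuousOn.congr (fun r hr => ?_) hW
  exact (hasDerivAt_radialPotential hR hκ hf.aestronglyMeasurable hfle
    hr).continuousAt.continuousWithinAt

theorem integrableOn_norm_rpow_mul {n : ℕ} (hn : 1 ≤ n) {R C a p τ : ℝ} (hp : 0 < p)
    (hτ : τ * p < a + n) {W : ℝ → ℝ} (hWc : ContinuousOn W (Set.Ioo 0 R))
    (hWle : ∀ t ∈ Set.Ioo 0 R, |W t| ≤ C * t ^ (-τ)) :
    IntegrableOn (fun x : EuclideanSpace ℝ (Fin n) => ‖x‖ ^ a * |W ‖x‖| ^ p)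
      (Metric.ball 0 R) := by
  have hIoo : ∀ x ∈ puncturedBall n R, ‖x‖ ∈ Set.Ioo 0 R := fun x hx => mem_puncturedBall.1 hx
  refine integrableOn_ball_of_le_rpow hn (s := τ * p - a) (C := |C| ^ p) (by linarith) ?_ ?_
  · refine (continuousOn_id.norm.rpow_const fun x hx => Or.inl (hIoo x hx).1.ne').mul ?_
    exact (hWc.comp continuousOn_id.norm hIoo).abs.rpow_const fun x _ => Or.inr hp.le
  · intro x hx
    have h0 := (hIoo x hx).1
    rw [abs_of_nonneg (by positivity)]
    calc _ ≤ ‖x‖ ^ a * (|C| * ‖x‖ ^ (-τ)) ^ p := by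
          gcongr
          refine (hWle _ (hIoo x hx)).trans ?_
          gcongr
          exact le_abs_self C
      _ = |C| ^ p * (‖x‖ ^ a * ‖x‖ ^ (-τ * p)) := by
          rw [Real.mul_rpow (abs_nonneg _) (by positivity), ← Real.rpow_mul h0.le]
          ring
      _ = _ := by rw [← Real.rpow_add h0]; ring_nf

/-- The choice of exponents for which the subcriticality condition is needed. -/
theorem exists_split_exponent {m α β : ℝ} (hm : 0 < m) (hα : 0 < α) (hβ : 0 < β)
    (h : m < α + β) : ∃ σ τ : ℝ, 0 ≤ σ ∧ 0 ≤ τ ∧ σ + τ = m ∧ τ < α ∧ σ < β := by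
  obtain ⟨τ, h1, h2⟩ := exists_between (show max 0 (m - β) < min α m from
    max_lt (lt_min hα hm) (lt_min (by linarith) (by linarith)))
  rw [max_lt_iff] at h1
  rw [lt_min_iff] at h2
  exact ⟨m - τ, τ, by linarith, h1.1.le, by ring, h2.1, by linarith⟩

end HenonLaneEmden

open HenonLaneEmden

theorem theorem1p3 (n : ℕ) (hn : 3 ≤ n) (p q : ℝ) (hp : 1 < p) (hq : 1 < q)
    (a b : ℝ) (ha : -(n : ℝ) < a) (hb : -(n : ℝ) < b)
    (hab : (n : ℝ) - 2 < (a + n) / p + (b + n) / q)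
    (R : ℝ) (hR : 0 < R) :
    ∃ lam₁ lam₂ : ℝ, 0 < lam₁ ∧ 0 < lam₂ ∧
      ∃ u v : EuclideanSpace ℝ (Fin n) → ℝ,
        HenonLaneEmden.IsRadialOn (HenonLaneEmden.originBall n R) u ∧
        HenonLaneEmden.IsRadialOn (HenonLaneEmden.originBall n R) v ∧
        HenonLaneEmden.IsPositiveDirichletSolution (HenonLaneEmden.originBall n R)
          a b p q lam₁ lam₂ u v ∧
        HenonLaneEmden.MemSobolev (HenonLaneEmden.originBall n R) 1 2 u ∧
        HenonLaneEmden.MemSobolev (HenonLaneEmden.originBall n R) 1 2 v ∧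
        HenonLaneEmden.MemSobolevZero (HenonLaneEmden.originBall n R) 1 u ∧
        HenonLaneEmden.MemSobolevZero (HenonLaneEmden.originBall n R) 1 v ∧
        IntegrableOn (fun x => ‖x‖ ^ b * |u x| ^ q) (Metric.ball 0 R) ∧
        IntegrableOn (fun x => ‖x‖ ^ a * |v x| ^ p) (Metric.ball 0 R) := by
  have hn' : (3 : ℝ) ≤ n := by exact_mod_cast hn
  have hp0 : 0 < p := by linarith
  have hq0 : 0 < q := by linarith
  obtain ⟨σ, τ, hσ, hτ, hστ, hτp, hσq⟩ := exists_split_exponent (m := (n : ℝ) - 2) (by linarith)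
    (div_pos (by linarith : 0 < a + n) hp0) (div_pos (by linarith : 0 < b + n) hq0) hab
  rw [lt_div_iff₀ hp0] at hτp
  rw [lt_div_iff₀ hq0] at hσq
  have := isFiniteMeasure_radialMeasure hR ha
  have := isFiniteMeasure_radialMeasure hR hb
  have hgm : ∀ γ : ℝ, Measurable fun t : ℝ => ENNReal.ofReal (t ^ γ) := fun γ => by fun_prop
  obtain ⟨U, V, c, C, hUm, hVm, hc0, hctop, hCtop, hU, hV, hUle, hVle, hU0, hV0⟩ :=
    exists_eigenpair (radialMeasure_ne_zero n a hR) (radialMeasure_ne_zero n b hR) hp hq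
      (measurable_greenKernel n R) (hgm (-τ)) (hgm (-σ))
      (greenKernel_le hn R hσ hτ hστ) (fun _ => ENNReal.ofReal_ne_top)
      (lintegral_rpow_radialMeasure_ne_top hR hp0 hτp)
      (lintegral_rpow_radialMeasure_ne_top hR hq0 hσq)
      (by
        filter_upwards [ae_mem_Ioo_radialMeasure n b R] with r hr
        filter_upwards [ae_mem_Ioo_radialMeasure n a R] with t ht
        exact greenKernel_ne_zero ht hr)
  have hτp1 : τ * (p - 1) < a + n := by nlinarith
  have hσq1 : σ * (q - 1) < b + n := by nlinarith
  -- The profiles may be infinite at the origin, where any positive value serves.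
  let WU : ℝ → ℝ := fun t => if t = 0 then 1 else (U t).toReal
  let WV : ℝ → ℝ := fun t => if t = 0 then 1 else (V t).toReal
  have hWUm : Measurable WU :=
    Measurable.ite (measurableSet_singleton 0) measurable_const hUm.ennreal_toReal
  have hWVm : Measurable WV :=
    Measurable.ite (measurableSet_singleton 0) measurable_const hVm.ennreal_toReal
  have hWU : ∀ t ∈ Set.Ioo 0 R, WU t = (U t).toReal := fun t ht => if_neg ht.1.ne'
  have hWV : ∀ t ∈ Set.Ioo 0 R, WV t = (V t).toReal := fun t ht => if_neg ht.1.ne'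
  obtain ⟨hfle, hfU⟩ := lintegral_greenKernel_radialMeasure hR (sub_pos.2 hp) hτp1 hVm hctop hCtop
    hVle hWVm hWV
  obtain ⟨hgle, hgV⟩ := lintegral_greenKernel_radialMeasure (n := n) hR (sub_pos.2 hq) hσq1 hUm
    ENNReal.one_ne_top hCtop hUle hWUm hWU
  have hUtop : ∀ t, U t ≠ ∞ := fun t =>
    ((hUle t).trans_lt (ENNReal.mul_lt_top hCtop.lt_top ENNReal.ofReal_lt_top)).ne
  have hVtop : ∀ t, V t ≠ ∞ := fun t =>
    ((hVle t).trans_lt (ENNReal.mul_lt_top hCtop.lt_top ENNReal.ofReal_lt_top)).ne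
  have hcpos : 0 < c.toReal := ENNReal.toReal_pos hc0 hctop
  have hkm : ∀ r, Measurable fun t => greenKernel n R t r := fun r =>
    (measurable_greenKernel n R).comp (measurable_id.prodMk measurable_const)
  -- A vanishing potential forces a vanishing density.
  have hkpos : ∀ (d P : ℝ) (F : ℝ → ℝ≥0∞), 0 < P - 1 → Measurable F →
      ∫⁻ t, F t ^ P ∂radialMeasure n d R ≠ 0 → ∀ r ∈ Set.Ioo 0 R,
      ∫⁻ t, greenKernel n R t r * F t ^ (P - 1) ∂radialMeasure n d R ≠ 0 := by
    intro d P F hP hF hF0 r hr h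
    apply hF0
    have hP0 : 0 < P := by linarith
    have hm : Measurable fun t => greenKernel n R t r * F t ^ (P - 1) :=
      (hkm r).mul (hF.pow_const _)
    have h1 := (lintegral_eq_zero_iff hm).1 h
    rw [lintegral_eq_zero_iff (hF.pow_const _)]
    filter_upwards [h1, ae_mem_Ioo_radialMeasure n d R] with t ht htm
    have h2 := (mul_eq_zero.1 ht).resolve_left (greenKernel_ne_zero htm hr)
    have h3 : F t = 0 := by
      by_contra hne
      exact (ENNReal.rpow_pos_of_nonneg (pos_iff_ne_zero.2 hne) hP.le).ne' h2
    simp [h3, hP0]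
  have hUpos : ∀ r ∈ Set.Ioo 0 R, 0 < WU r := by
    intro r hr
    rw [hWU r hr]
    refine ENNReal.toReal_pos ?_ (hUtop r)
    rw [hU r]
    exact mul_ne_zero hc0 (hkpos a p V (sub_pos.2 hp) hVm hV0 r hr)
  have hV' : ∀ r, V r = 1 * ∫⁻ t, greenKernel n R t r * U t ^ (q - 1) ∂radialMeasure n b R := by
    intro r
    rw [hV r, one_mul]
    simp_rw [greenKernel_comm n R r]
  have hVpos : ∀ r ∈ Set.Ioo 0 R, 0 < WV r := by
    intro r hr
    rw [hWV r hr]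
    refine ENNReal.toReal_pos ?_ (hVtop r)
    rw [hV' r]
    exact mul_ne_zero one_ne_zero (hkpos b q U (sub_pos.2 hq) hUm hU0 r hr)
  have hEU : ∀ r ∈ Set.Ioo 0 R, WU r
      = radialPotential n R (fun t => c.toReal * t ^ a * WV t ^ (p - 1)) r := by
    intro r hr
    have h := hUpos r hr
    rw [hWU r hr, hU r, hfU r hr] at h ⊢
    exact ENNReal.toReal_ofReal (ENNReal.ofReal_pos.1 (ENNReal.toReal_pos_iff.1 h).1).le
  have hEV : ∀ r ∈ Set.Ioo 0 R, WV r
      = radialPotential n R (fun t => (1 : ℝ≥0∞).toReal * t ^ b * WU t ^ (q - 1)) r := by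
    intro r hr
    have h := hVpos r hr
    rw [hWV r hr, hV' r, hgV r hr] at h ⊢
    exact ENNReal.toReal_ofReal (ENNReal.ofReal_pos.1 (ENNReal.toReal_pos_iff.1 h).1).le
  have hκU : 0 < a + n - τ * (p - 1) := by linarith
  have hκV : 0 < b + n - σ * (q - 1) := by linarith
  have hWUc := continuousOn_of_eq_radialPotential hR hκU (by fun_prop) hfle hEU
  have hWVc := continuousOn_of_eq_radialPotential hR hκV (by fun_prop) hgle hEV
  have hdens : ∀ (e γ P : ℝ) (W : ℝ → ℝ), 0 < P - 1 → ContinuousOn W (Set.Ioo 0 R) →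
      ContinuousOn (fun t => e * t ^ γ * W t ^ (P - 1)) (Set.Ioo 0 R) := fun e γ P W hP hW =>
    (continuousOn_const.mul (continuousOn_id.rpow_const fun t ht => Or.inl ht.1.ne')).mul
      (hW.rpow_const fun t _ => Or.inr hP.le)
  obtain ⟨hu0, hu2, hue⟩ := negLaplacianEq_radialPotential hn hR hκU (by positivity)
    (hdens _ a p WV (sub_pos.2 hp) hWVc) hfle hEU
  obtain ⟨hv0, hv2, hve⟩ := negLaplacianEq_radialPotential hn hR hκV (by positivity)
    (hdens _ b q WU (sub_pos.2 hq) hWUc) hgle hEV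
  have hball : ∀ W : ℝ → ℝ, W 0 = 1 → (∀ r ∈ Set.Ioo 0 R, 0 < W r) →
      ∀ x ∈ originBall n R, 0 < W ‖x‖ := by
    intro W hW0 hW x hx
    have hx' : ‖x‖ < R := mem_ball_zero_iff.1 hx
    rcases (norm_nonneg x).eq_or_lt with h | h
    · rw [← h, hW0]
      exact one_pos
    · exact hW _ ⟨h, hx'⟩
  have hbound : ∀ (γ : ℝ) (F : ℝ → ℝ≥0∞), (∀ t, F t ≤ C * ENNReal.ofReal (t ^ (-γ))) →
      ∀ t ∈ Set.Ioo 0 R, |(F t).toReal| ≤ C.toReal * t ^ (-γ) := by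
    intro γ F hF t ht
    have h := ENNReal.toReal_mono (ENNReal.mul_ne_top hCtop ENNReal.ofReal_ne_top) (hF t)
    rw [ENNReal.toReal_mul, ENNReal.toReal_ofReal (Real.rpow_nonneg ht.1.le _)] at h
    rwa [abs_of_nonneg ENNReal.toReal_nonneg]
  refine ⟨c.toReal, (1 : ℝ≥0∞).toReal, hcpos, by simp, fun x => WU ‖x‖, fun x => WV ‖x‖,
    ⟨WU, fun _ _ => rfl⟩, ⟨WV, fun _ _ => rfl⟩,
    ⟨hue, hve, hball WU (if_pos rfl) hUpos, hball WV (if_pos rfl) hVpos, hu0, hv0⟩,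
    hu2, hv2, hu0, hv0,
    integrableOn_norm_rpow_mul (C := C.toReal) (by omega) hq0 hσq hWUc fun t ht => ?_,
    integrableOn_norm_rpow_mul (C := C.toReal) (by omega) hp0 hτp hWVc fun t ht => ?_⟩
  · rw [hWU t ht]
    exact hbound σ U hUle t ht
  · rw [hWV t ht]
    exact hbound τ V hVle t ht
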